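/- Consider a time-slotted network with $M$ base stations (BSs), $n$ users, and a set of associated (BS, user) pairs, called links; each link $l=(m,u)$ has a queue with length $Q_l(t)\in\mathbb N$ at the beginning of slot $t$. In slot $t$ the activation state is $J(t)\in\mathcal J=\{0,1\}^M$, the channel state $H(t)$ takes values in a finite set $\mathcal H$, is i.i.d. over time with probability mass function $\mu$, and consists of one component per BS; $h|_j$ is the restriction of $h$ to the BSs that are active in $j$. For each $h$ a finite non-empty set $\mathcal R(\mathbf 1,h)$ of nonnegative integer rate vectors is given. For a rate vector $r$, $r\circ j$ is $r$ with the rates of all links of inactive BSs set to $0$; one assumes $\mathcal R(\mathbf 1,h)\circ j\subseteq\mathcal R(\mathbf 1,h)$, puts $\mathcal R(j,h)=\mathcal R(\mathbf 1,h)\circ j$, and this set depends on $h$ only through $h|_j$. The arrival vectors $A(t)$ are bounded, integer-valued, i.i.d. over time, independent of the channel states, with mean vector $\lambda$. A Markov policy chooses $J(t)$ (possibly at random) on the basis of $(J(t-1),Q(t))$, and then $S(t)\in\mathcal R(J(t),H(t))$ on the basis of $(J(t-1),Q(t),J(t),H(t)|_{J(t)})$; the queues evolve by $Q(t+1)=(Q(t)+A(t)-S(t))^+$.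 The cost of slot $t$ is $C(t)=\mathsf C_0\|(J(t-1)-J(t))^+\|_1+\mathsf C_1\|J(t)\|_1$ with $\mathsf C_0,\mathsf C_1\ge 0$, and the network cost of a policy $\varphi$, given the initial condition $(J(0),Q(1))$, is $C^\varphi(\mu,\lambda)=\limsup_{T\to\infty}\frac1T\sum_{t=1}^T\mathbb E_\varphi[C(t)\mid J(0),Q(1)]$. The network is stable under $\varphi$ if there are constants $\bar Q,\rho>0$ such that for every initial condition $\liminf_{T\to\infty}\frac1T\sum_{t=1}^T\mathbb P_\varphi[\sum_l Q_l(t)\le\bar Q\mid J(0),Q(1)]>\rho$. Let $\mathfrak M$ be the set of Markov policies (which may depend on the arrival and channel statistics) for which the chain $(J(t-1),Q(t))$ is ergodic, that is, has a single positive recurrent class, which is reached almost surely from every state. Let $C^{\mathfrak M}(\mu,\lambda)$ be the infimum of the network costs of the policies in $\mathfrak M$ under which the network is stable (the infimum of the empty set being $+\infty$), and let $\mathcal S$ be the set of pairs $(\mu,v)$ such that for some arrival process as above with mean vector $v$ the network is stable under some policy in $\mathfrak M$. For a scalar $a$ write $\lambda+a$ for $\lambda+a\mathbf 1$. For a vector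 $v$ indexed by the links let $L_{\mathbf c^0}(\mu,v)$ be the linear program of minimizing $\mathsf C_1\sum_{j\in\mathcal J}\sigma_j\|j\|_1$ over probability vectors $\sigma$ on $\mathcal J$ and numbers $\beta_{j,h,r}\ge 0$ ($r\in\mathcal R(j,h)$) subject to $\sigma_j=\sum_{r\in\mathcal R(j,h)}\beta_{j,h,r}$ for all $j,h$, and $v\le\sum_{j,h}\sum_{r\in\mathcal R(j,h)}\beta_{j,h,r}\,\mu(h)\,r$. For a solution $(\sigma^*,\beta^*)$ of $L_{\mathbf c^0}(\mu,\lambda+\epsilon_g)$ and $\epsilon_s\in(0,1)$, the static-split + Max-Weight rule $\varphi(\mu,\lambda+\epsilon_g,\epsilon_s)$ selects $J(t)$ given $J(t-1)$ by the stochastic matrix $\mathbf P(\sigma^*,\epsilon_s)=\epsilon_s\mathbf 1\sigma^*+(1-\epsilon_s)\mathbf I$, and $S(t)\in\arg\max_{r\in\mathcal R(J(t),H(t))}Q(t)\cdot r$, with ties broken arbitrarily. **Theorem.** There is a constant $\kappa$ that depends only on $M$, $n$, $\mathsf C_0$, $\mathsf C_1$ such that for any network as above and any $\mu,\lambda$ there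 is an increasing function $\gamma$ on $(0,\infty)$ with $\lim_{\epsilon_g\to 0}\gamma(\epsilon_g)=0$ such that the following holds. For all $\epsilon_g>0$ with $(\mu,\lambda+2\epsilon_g)\in\mathcal S$ and all $\epsilon_s\in(0,1)$, the linear program $L_{\mathbf c^0}(\mu,\lambda+\epsilon_g)$ has an optimal solution, for each of its optimal solutions a static-split + Max-Weight rule exists, and under every such rule, for every arrival process as above with mean vector $\lambda$, 1. for every initial condition, $C^{\varphi(\mu,\lambda+\epsilon_g,\epsilon_s)}(\mu,\lambda)\le C^{\mathfrak M}(\mu,\lambda)+\kappa\,\epsilon_s+\gamma(\epsilon_g)$, and 2. the network is stable under $\varphi(\mu,\lambda+\epsilon_g,\epsilon_s)$. -/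

import Mathlib

open Filter Topology Set

universe u

noncomputable section

namespace SwitchNet

/-- An activation state `j ∈ {0,1}^M`: `j m = true` iff base station (BS) `m` is ON. -/
abbrev Activation (M : ℕ) : Type := Fin M → Bool

/-- The number `1` if BS `m` is ON in `j`, and `0` otherwise. -/
def onInd {M : ℕ} (j : Activation M) (m : Fin M) : ℝ := if j m = true then 1 else 0

/-- `‖j‖₁`, the number of active BSs. -/
def activeCount {M : ℕ} (j : Activation M) : ℝ := ∑ m, onInd j m

/-- `‖(j' - j)⁺‖₁`, the number of BSs that are ON in `j'` and OFF in `j`. -/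
def offCount {M : ℕ} (j' j : Activation M) : ℝ := ∑ m, max (onInd j' m - onInd j m) 0

/-- The product `r ∘ j`: the rates of all links of inactive BSs are set to zero. -/
def mask {M n : ℕ} {E : Finset (Fin M × Fin n)} (j : Activation M) (r : E → ℕ) : E → ℕ :=
  fun l => if j l.1.1 = true then r l else 0

/-- The deterministic data of a network with `M` base stations and `n` users.
A network channel state is a family `h = (h_m)`, where `h_m : X` is the state of all the channels
of BS `m`; its restriction `h|_j` is the family of the `h_m` with `m` active in `j`. -/
structure Network (M n : ℕ) (X : Type u) where
  /-- the (BS, user) pairs that are associated with each other; each of them has a queue -/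
  assoc : Finset (Fin M × Fin n)
  /-- the finite set of network channel states -/
  channelStates : Finset (Fin M → X)
  /-- the finite set `R(1, h)` of rate vectors that are achievable when all BSs are ON -/
  fullRates : channelStates → Finset (assoc → ℕ)
  /-- some rate vector is always available -/
  fullRates_nonempty : ∀ h, (fullRates h).Nonempty
  /-- `R(1, h) ∘ j ⊆ R(1, h)` -/
  mask_mem : ∀ h j, ∀ r ∈ fullRates h, mask j r ∈ fullRates h
  /-- `R(j, h) = R(1, h) ∘ j` is known to a scheduler that observes `h|_j` -/
  rates_local : ∀ (j : Activation M) (h h' : channelStates),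
    (∀ m, j m = true → h.1 m = h'.1 m) →
      (fullRates h).image (mask j) = (fullRates h').image (mask j)

namespace Network

variable {M n : ℕ} {X : Type u} (N : Network M n X)

/-- The links, that is, the associated (BS, user) pairs. -/
abbrev Link : Type := {p : Fin M × Fin n // p ∈ N.assoc}

/-- The network channel states. -/
abbrev Channel : Type u := {h : Fin M → X // h ∈ N.channelStates}

/-- The network state `(J(t-1), Q(t))`. -/
abbrev State : Type := Activation M × (N.Link → ℕ)

/-- `R(j, h) := R(1, h) ∘ j`. -/
def rateSet (j : Activation M) (h : N.Channel) : Finset (N.Link → ℕ) :=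
  (N.fullRates h).image (mask j)

/-- The law of the arrival vector of one time slot. The arrivals of different slots are independent
with this common law; every queue receives at most `bound` packets in a slot. -/
structure Arrivals where
  bound : ℕ
  law : PMF (N.Link → Fin (bound + 1))

/-- The vector of the mean arrival rates. -/
def Arrivals.rate {N : Network M n X} (A : N.Arrivals) : N.Link → ℝ :=
  fun l => ∑ a : N.Link → Fin (A.bound + 1), (A.law a).toReal * ((a l : ℕ) : ℝ)

/-- A randomized policy whose decisions depend on the network state `x = (J(t-1), Q(t))`.
The activation state `J(t)` has law `act x`; the rate vector `S(t)`, given `J(t) = j` and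
`H(t) = h`, has law `alloc x j h`, lies in `R(j, h)`, and depends on `h` only through `h|_j`. -/
structure Policy where
  act : N.State → PMF (Activation M)
  alloc : N.State → Activation M → N.Channel → PMF (N.Link → ℕ)
  alloc_mem : ∀ x j h, ∀ r ∈ (alloc x j h).support, r ∈ N.rateSet j h
  alloc_obs : ∀ x j (h h' : N.Channel), (∀ m, j m = true → h.1 m = h'.1 m) →
    alloc x j h = alloc x j h'

variable {N}
variable (μ : PMF N.Channel) (A : N.Arrivals) (φ : N.Policy)

/-- The one-step transition law of the network state under `φ`: the channel state has law `μ`, and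
`J(t)`, `H(t)`, `S(t)`, `A(t)` lead from `(J(t-1), Q(t))` to
`(J(t), (Q(t) + A(t) - S(t))⁺)` (subtraction of natural numbers is truncated). -/
def step (x : N.State) : PMF N.State :=
  (φ.act x).bind fun j => μ.bind fun h => (φ.alloc x j h).bind fun r =>
    A.law.map fun a => (j, fun l => x.2 l + (a l : ℕ) - r l)

/-- The law of the network state `(J(t), Q(t+1))` given `(J(0), Q(1)) = x`. -/
def stateLaw (x : N.State) : ℕ → PMF N.State
  | 0 => PMF.pure x
  | t + 1 => (stateLaw x t).bind (step μ A φ)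

/-- The probability of `∑ Q(t+1) ≤ Qbar` given `(J(0), Q(1)) = x`. -/
def queueProb (x : N.State) (Qbar : ℝ) (t : ℕ) : ℝ :=
  ((stateLaw μ A φ x t).toOuterMeasure {y | ∑ l, (y.2 l : ℝ) ≤ Qbar}).toReal

/-- Stability of the network under `φ`. -/
def Stable : Prop :=
  ∃ Qbar ρ : ℝ, 0 < Qbar ∧ 0 < ρ ∧ ∀ x : N.State,
    ρ < liminf (fun T : ℕ => (1 / (T : ℝ)) * ∑ t ∈ Finset.range T, queueProb μ A φ x Qbar t) atTop

/-- The network state process under `φ` is ergodic: there is a probability `π` such that, from every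
initial state, the expected fraction of time spent in any state `y` tends to `π y`. Equivalently,
there is a single positive recurrent class, which is reached almost surely from every state. -/
def Ergodic : Prop :=
  ∃ π : PMF N.State, ∀ x y : N.State,
    Tendsto (fun T : ℕ => (1 / (T : ℝ)) * ∑ t ∈ Finset.range T, (stateLaw μ A φ x t y).toReal)
      atTop (𝓝 (π y).toReal)

/-- The capacity set: all pairs of a channel law and a rate vector such that some arrival process
with this rate vector is stable under some ergodic Markov policy. -/
def capacitySet (N : Network M n X) : Set (PMF N.Channel × (N.Link → ℝ)) :=
  {p | ∃ A : N.Arrivals, A.rate = p.2 ∧ ∃ φ : N.Policy, Ergodic p.1 A φ ∧ Stable p.1 A φ}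

/-- The joint law of `(J(t), J(t+1))` given `(J(0), Q(1)) = x`. -/
def switchLaw (x : N.State) (t : ℕ) : PMF (Activation M × Activation M) :=
  (stateLaw μ A φ x t).bind fun y => (φ.act y).map fun j => (y.1, j)

/-- The cost of the slot in which the activation state changes from `j'` to `j`. -/
def slotCost (C₀ C₁ : ℝ) (j' j : Activation M) : ℝ :=
  C₀ * offCount j' j + C₁ * activeCount j

/-- The expected cost of slot `t + 1` given `(J(0), Q(1)) = x`. -/
def expectedCost (C₀ C₁ : ℝ) (x : N.State) (t : ℕ) : ℝ :=
  ∑ p : Activation M × Activation M, (switchLaw μ A φ x t p).toReal * slotCost C₀ C₁ p.1 p.2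

/-- The network cost of `φ`: the long-term average expected cost per slot. -/
def networkCost (C₀ C₁ : ℝ) (x : N.State) : EReal :=
  limsup (fun T : ℕ =>
    (((1 / (T : ℝ)) * ∑ t ∈ Finset.range T, expectedCost μ A φ C₀ C₁ x t : ℝ) : EReal)) atTop

/-- The optimal network cost: the infimum over the ergodic Markov policies under which the network
is stable. -/
def optimalCost (C₀ C₁ : ℝ) (x : N.State) : EReal :=
  ⨅ ψ : N.Policy, ⨅ _ : Ergodic μ A ψ ∧ Stable μ A ψ, networkCost μ A ψ C₀ C₁ x

/-- Feasibility of `(σ, β)` for the linear program with parameters `(μ, v)`. The variables are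
`σ j` and `β j h r` with `r ∈ R(j, h)`; other values of `β` are never used. -/
structure LPFeasible (v : N.Link → ℝ) (σ : Activation M → ℝ)
    (β : Activation M → N.Channel → (N.Link → ℕ) → ℝ) : Prop where
  σ_nonneg : ∀ j, 0 ≤ σ j
  σ_sum : ∑ j, σ j = 1
  β_nonneg : ∀ j h, ∀ r ∈ N.rateSet j h, 0 ≤ β j h r
  β_sum : ∀ j h, σ j = ∑ r ∈ N.rateSet j h, β j h r
  demand : ∀ l, v l ≤ ∑ j, ∑ h, ∑ r ∈ N.rateSet j h, β j h r * (μ h).toReal * (r l : ℝ)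

/-- The objective `C₁ ∑ σ_j ‖j‖₁`. -/
def lpObjective (C₁ : ℝ) (σ : Activation M → ℝ) : ℝ := C₁ * ∑ j, σ j * activeCount j

/-- `(σ, β)` is an optimal solution of the linear program. -/
def LPOptimal (C₁ : ℝ) (v : N.Link → ℝ) (σ : Activation M → ℝ)
    (β : Activation M → N.Channel → (N.Link → ℕ) → ℝ) : Prop :=
  LPFeasible μ v σ β ∧ ∀ σ' β', LPFeasible μ v σ' β' → lpObjective C₁ σ ≤ lpObjective C₁ σ'

/-- The stochastic matrix `P(σ, ε) = ε 𝟏 σ + (1 - ε) I`. -/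
def lazyMatrix (σ : Activation M → ℝ) (ε : ℝ) : Matrix (Activation M) (Activation M) ℝ :=
  ε • Matrix.of (fun _ j => σ j) + (1 - ε) • (1 : Matrix (Activation M) (Activation M) ℝ)

/-- `r` maximizes `q · r` over `R(j, h)`. -/
def IsMaxWeight (q : N.Link → ℕ) (j : Activation M) (h : N.Channel) (r : N.Link → ℕ) : Prop :=
  r ∈ N.rateSet j h ∧ ∀ r' ∈ N.rateSet j h, ∑ l, q l * r' l ≤ ∑ l, q l * r l

/-- `φ` is a static-split + Max-Weight rule: activation by the chain `P(σ, ε)`, and rate allocation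
by the Max-Weight rule, with ties broken in an arbitrary way. -/
def IsStaticSplitMaxWeight (σ : Activation M → ℝ) (ε : ℝ) : Prop :=
  (∀ x j, (φ.act x j).toReal = lazyMatrix σ ε x.1 j) ∧
    ∀ x j h, ∀ r ∈ (φ.alloc x j h).support, IsMaxWeight x.2 j h r

end Network

end SwitchNet

end

/-! The optimal value of the linear program serves as a common yardstick for both costs.

Lower bound. Under an ergodic policy, the time averages of the law of `J(t)` and of the conditional
allocation probabilities given the channel state satisfy every constraint of the program with demand
`lam - δ`, once the horizon is long: the channel state is independent of the network state and of
`J(t)`, so the mean service has exactly the form of the demand constraint, and ergodicity limits the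
time spent with long queues. Dropping the switching cost bounds the objective by the average cost.
Compactness lets `δ` tend to `0` (`Ergodic.eventually_lpFeasible`,
`exists_lpFeasible_of_forall_sub`). Convexity of the program in its demand then makes the value at
`lam + εg` exceed that at `lam` by at most a multiple of `εg` (`LPOptimal.objective_le`); this is
`γ`.

Upper bound. The chain `P(σ, ε)` redraws its state from `σ` with probability `ε` and otherwise stays
put. Hence switching costs at most `C₀ * M * ε` per slot, and the mean number of active stations
converges geometrically to its mean under `σ` (`networkCost_le`).

Stability. The slow activation chain spoils the one-step drift of the squared queue lengths.
Subtracting `2 (1 - ε) / ε` times the expected maximal weight of the current activation state, a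
solution of the Poisson equation of the chain, replaces the current state by its average under `σ`;
there the slack `εg` in the demand gives a negative drift (`expect_step_lyapunov_le`). -/

open scoped ENNReal

namespace SwitchNet

/-- The expectation of a nonnegative function under a probability mass function. -/
noncomputable def expect {α : Type*} (p : PMF α) (f : α → ℝ≥0∞) : ℝ≥0∞ := ∑' a, p a * f a

/-! ### Expectations with values in `[0, ∞]` -/

section Expect

variable {α β : Type*} (p : PMF α)

theorem expect_bind (k : α → PMF β) (f : β → ℝ≥0∞) :
    expect (p.bind k) f = expect p fun a => expect (k a) f := by
  simp only [expect, PMF.bind_apply, ← ENNReal.tsum_mul_right, ← ENNReal.tsum_mul_left]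
  rw [ENNReal.tsum_comm]
  simp only [mul_assoc]

theorem expect_pure (a : α) (f : α → ℝ≥0∞) : expect (PMF.pure a) f = f a := by
  rw [expect, tsum_eq_single a]
  · simp
  · intro b hb
    simp [hb]

theorem expect_map (g : α → β) (f : β → ℝ≥0∞) :
    expect (p.map g) f = expect p fun a => f (g a) := by
  rw [← PMF.bind_pure_comp, expect_bind]
  simp [expect_pure]

theorem expect_mono_support {f g : α → ℝ≥0∞} (h : ∀ a ∈ p.support, f a ≤ g a) :
    expect p f ≤ expect p g := by
  refine ENNReal.tsum_le_tsum fun a => ?_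
  by_cases ha : p a = 0
  · simp [ha]
  · gcongr
    exact h a ha

theorem expect_mono {f g : α → ℝ≥0∞} (h : ∀ a, f a ≤ g a) : expect p f ≤ expect p g :=
  expect_mono_support p fun a _ => h a

theorem expect_const (c : ℝ≥0∞) : expect p (fun _ => c) = c := by
  rw [expect, ENNReal.tsum_mul_right, p.tsum_coe, one_mul]

theorem expect_add (f g : α → ℝ≥0∞) :
    expect p (fun a => f a + g a) = expect p f + expect p g := by
  simp only [expect, mul_add, ENNReal.tsum_add]

theorem expect_const_mul (c : ℝ≥0∞) (f : α → ℝ≥0∞) :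
    expect p (fun a => c * f a) = c * expect p f := by
  simp only [expect, ← ENNReal.tsum_mul_left]
  exact tsum_congr fun a => by ring

theorem expect_mul_const (c : ℝ≥0∞) (f : α → ℝ≥0∞) :
    expect p (fun a => f a * c) = expect p f * c := by
  simp only [mul_comm _ c, expect_const_mul]

theorem expect_finset_sum {ι : Type*} (s : Finset ι) (f : ι → α → ℝ≥0∞) :
    expect p (fun a => ∑ i ∈ s, f i a) = ∑ i ∈ s, expect p (f i) := by
  classical
  induction s using Finset.induction_on with
  | empty => simp [expect_const]
  | insert i s hi ih => simp only [Finset.sum_insert hi, expect_add, ih]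

theorem expect_le_of_le {f : α → ℝ≥0∞} {c : ℝ≥0∞} (h : ∀ a, f a ≤ c) : expect p f ≤ c :=
  (expect_mono p h).trans (expect_const p c).le

theorem expect_eq_sum_of_support [DecidableEq α] {s : Finset α} (h : ∀ a ∈ p.support, a ∈ s)
    (f : α → ℝ≥0∞) : expect p f = ∑ a ∈ s, p a * f a := by
  refine tsum_eq_sum fun a ha => ?_
  rw [(PMF.apply_eq_zero_iff p a).2 fun h' => ha (h a h'), zero_mul]

theorem expect_eq_sum [Fintype α] (f : α → ℝ≥0∞) : expect p f = ∑ a, p a * f a :=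
  tsum_fintype _

theorem sum_toReal_eq_one [Fintype α] : ∑ a, (p a).toReal = 1 := by
  rw [← ENNReal.toReal_sum fun a _ => p.apply_ne_top a, ← tsum_fintype (L := .unconditional _),
    p.tsum_coe, ENNReal.toReal_one]

theorem expect_ofReal [Fintype α] {f : α → ℝ} (hf : ∀ a, 0 ≤ f a) :
    expect p (fun a => ENNReal.ofReal (f a)) = ENNReal.ofReal (∑ a, (p a).toReal * f a) := by
  rw [expect_eq_sum, ENNReal.ofReal_sum_of_nonneg
    fun a _ => mul_nonneg ENNReal.toReal_nonneg (hf a)]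
  refine Finset.sum_congr rfl fun a _ => ?_
  rw [ENNReal.ofReal_mul ENNReal.toReal_nonneg, ENNReal.ofReal_toReal (p.apply_ne_top a)]

theorem toReal_expect_ofReal [Fintype α] {f : α → ℝ} (hf : ∀ a, 0 ≤ f a) :
    (expect p fun a => ENNReal.ofReal (f a)).toReal = ∑ a, (p a).toReal * f a := by
  rw [expect_ofReal p hf, ENNReal.toReal_ofReal
    (Finset.sum_nonneg fun a _ => mul_nonneg ENNReal.toReal_nonneg (hf a))]

end Expect

namespace Network

variable {M n : ℕ} {X : Type u} {N : Network M n X}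
variable (μ : PMF N.Channel) (A : N.Arrivals) (φ : N.Policy)

/-! ### One-step expectations and telescoping of drift inequalities -/

theorem expect_step (x : N.State) (f : N.State → ℝ≥0∞) :
    expect (step μ A φ x) f = expect (φ.act x) fun j => expect μ fun h =>
      expect (φ.alloc x j h) fun r => expect A.law fun a =>
        f (j, fun l => x.2 l + (a l : ℕ) - r l) := by
  simp only [step, expect_bind, expect_map]

theorem expect_stateLaw_succ (x : N.State) (t : ℕ) (f : N.State → ℝ≥0∞) :
    expect (stateLaw μ A φ x (t + 1)) f =
      expect (stateLaw μ A φ x t) fun y => expect (step μ A φ y) f :=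
  expect_bind _ _ _

/-- The drift condition is written without subtraction, so it makes sense in `[0, ∞]` and needs no
integrability of `f`, `g` or `k`. -/
theorem telescope_le {f g k : N.State → ℝ≥0∞}
    (h : ∀ y, expect (step μ A φ y) f + g y ≤ f y + k y) (x : N.State) (T : ℕ) :
    expect (stateLaw μ A φ x T) f + ∑ t ∈ Finset.range T, expect (stateLaw μ A φ x t) g ≤
      f x + ∑ t ∈ Finset.range T, expect (stateLaw μ A φ x t) k := by
  induction T with
  | zero => simp [stateLaw, expect_pure]
  | succ T ih =>
    have h1 := expect_mono (stateLaw μ A φ x T) h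
    rw [expect_add, expect_add, ← expect_stateLaw_succ] at h1
    rw [Finset.sum_range_succ, Finset.sum_range_succ]
    calc _ = (expect (stateLaw μ A φ x (T + 1)) f + expect (stateLaw μ A φ x T) g) +
          ∑ t ∈ Finset.range T, expect (stateLaw μ A φ x t) g := by ring
      _ ≤ (expect (stateLaw μ A φ x T) f + expect (stateLaw μ A φ x T) k) +
          ∑ t ∈ Finset.range T, expect (stateLaw μ A φ x t) g := by gcongr
      _ = (expect (stateLaw μ A φ x T) f +
          ∑ t ∈ Finset.range T, expect (stateLaw μ A φ x t) g) +
            expect (stateLaw μ A φ x T) k := by ring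
      _ ≤ (f x + ∑ t ∈ Finset.range T, expect (stateLaw μ A φ x t) k) +
            expect (stateLaw μ A φ x T) k := by gcongr
      _ = _ := by ring

theorem le_telescope {f g k : N.State → ℝ≥0∞}
    (h : ∀ y, f y + k y ≤ expect (step μ A φ y) f + g y) (x : N.State) (T : ℕ) :
    f x + ∑ t ∈ Finset.range T, expect (stateLaw μ A φ x t) k ≤
      expect (stateLaw μ A φ x T) f + ∑ t ∈ Finset.range T, expect (stateLaw μ A φ x t) g := by
  induction T with
  | zero => simp [stateLaw, expect_pure]
  | succ T ih =>
    have h1 := expect_mono (stateLaw μ A φ x T) h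
    rw [expect_add, expect_add, ← expect_stateLaw_succ] at h1
    rw [Finset.sum_range_succ, Finset.sum_range_succ]
    calc _ = (f x + ∑ t ∈ Finset.range T, expect (stateLaw μ A φ x t) k) +
            expect (stateLaw μ A φ x T) k := by ring
      _ ≤ (expect (stateLaw μ A φ x T) f +
          ∑ t ∈ Finset.range T, expect (stateLaw μ A φ x t) g) +
            expect (stateLaw μ A φ x T) k := by gcongr
      _ = (expect (stateLaw μ A φ x T) f + expect (stateLaw μ A φ x T) k) +
          ∑ t ∈ Finset.range T, expect (stateLaw μ A φ x t) g := by ring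
      _ ≤ (expect (stateLaw μ A φ x (T + 1)) f + expect (stateLaw μ A φ x T) g) +
          ∑ t ∈ Finset.range T, expect (stateLaw μ A φ x t) g := by gcongr
      _ = _ := by ring

variable (N) in
theorem exists_rate_bound :
    ∃ R : ℕ, ∀ j h, ∀ r ∈ N.rateSet j h, ∀ l, r l ≤ R := by
  refine ⟨∑ j, ∑ h, ∑ r ∈ N.rateSet j h, ∑ l, r l, fun j h r hr l => ?_⟩
  calc r l ≤ ∑ l, r l := Finset.single_le_sum (fun _ _ => Nat.zero_le _) (Finset.mem_univ l)
    _ ≤ ∑ r ∈ N.rateSet j h, ∑ l, r l :=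
      Finset.single_le_sum (f := fun r : N.Link → ℕ => ∑ l, r l) (fun _ _ => Nat.zero_le _) hr
    _ ≤ ∑ h, ∑ r ∈ N.rateSet j h, ∑ l, r l :=
      Finset.single_le_sum (f := fun h => ∑ r ∈ N.rateSet j h, ∑ l, r l)
        (fun _ _ => Nat.zero_le _) (Finset.mem_univ h)
    _ ≤ _ := Finset.single_le_sum (f := fun j => ∑ h, ∑ r ∈ N.rateSet j h, ∑ l, r l)
        (fun _ _ => Nat.zero_le _) (Finset.mem_univ j)

theorem expect_arrival (l : N.Link) :
    expect A.law (fun a => ((a l : ℕ) : ℝ≥0∞)) = ENNReal.ofReal (A.rate l) := by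
  have h := expect_ofReal A.law (f := fun a => ((a l : ℕ) : ℝ)) fun a => by positivity
  simp only [ENNReal.ofReal_natCast] at h
  exact h

variable {μ A φ}

theorem activeCount_nonneg (j : Activation M) : 0 ≤ activeCount j :=
  Finset.sum_nonneg fun m _ => by unfold onInd; split_ifs <;> norm_num

theorem activeCount_le (j : Activation M) : activeCount j ≤ M := by
  calc activeCount j ≤ ∑ _m : Fin M, (1 : ℝ) :=
        Finset.sum_le_sum fun m _ => by unfold onInd; split_ifs <;> norm_num
    _ = M := by simp

theorem offCount_nonneg (j' j : Activation M) : 0 ≤ offCount j' j :=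
  Finset.sum_nonneg fun _ _ => le_max_right _ _

theorem offCount_le (j' j : Activation M) : offCount j' j ≤ M := by
  calc offCount j' j ≤ ∑ _m : Fin M, (1 : ℝ) :=
        Finset.sum_le_sum fun m _ => by unfold onInd; split_ifs <;> norm_num
    _ = M := by simp

theorem offCount_self (j : Activation M) : offCount j j = 0 := by simp [offCount]

/-! ### The linear program: compactness, existence of optima, convexity in the demand -/

theorem lpObjective_nonneg {C₁ : ℝ} (hC₁ : 0 ≤ C₁) {σ : Activation M → ℝ} (h : ∀ j, 0 ≤ σ j) :
    0 ≤ lpObjective C₁ σ :=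
  mul_nonneg hC₁ (Finset.sum_nonneg fun j _ => mul_nonneg (h j) (activeCount_nonneg j))

theorem lpObjective_le {C₁ : ℝ} (hC₁ : 0 ≤ C₁) {σ : Activation M → ℝ} (h : ∀ j, 0 ≤ σ j)
    (h1 : ∑ j, σ j = 1) : lpObjective C₁ σ ≤ C₁ * M := by
  refine mul_le_mul_of_nonneg_left ?_ hC₁
  calc ∑ j, σ j * activeCount j ≤ ∑ j, σ j * M :=
        Finset.sum_le_sum fun j _ => mul_le_mul_of_nonneg_left (activeCount_le j) (h j)
    _ = M := by rw [← Finset.sum_mul, h1, one_mul]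

theorem LPFeasible.mono {v w : N.Link → ℝ} {σ β} (h : LPFeasible μ v σ β) (hw : ∀ l, w l ≤ v l) :
    LPFeasible μ w σ β :=
  ⟨h.σ_nonneg, h.σ_sum, h.β_nonneg, h.β_sum, fun l => (hw l).trans (h.demand l)⟩

variable (μ) in
/-- The feasible points in the unit cube with objective at most `c`. -/
def lpSublevel (C₁ : ℝ) (v : N.Link → ℝ) (c : ℝ) :
    Set ((Activation M → ℝ) × (Activation M → N.Channel → (N.Link → ℕ) → ℝ)) :=
  {p | LPFeasible μ v p.1 p.2 ∧ p ∈ Icc 0 1 ∧ lpObjective C₁ p.1 ≤ c}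

theorem isClosed_lpFeasible (v : N.Link → ℝ) :
    IsClosed {p : (Activation M → ℝ) × (Activation M → N.Channel → (N.Link → ℕ) → ℝ) |
      LPFeasible μ v p.1 p.2} := by
  have : {p : (Activation M → ℝ) × (Activation M → N.Channel → (N.Link → ℕ) → ℝ) |
      LPFeasible μ v p.1 p.2} = {p | (∀ j, 0 ≤ p.1 j) ∧ ∑ j, p.1 j = 1 ∧
        (∀ j h, ∀ r ∈ N.rateSet j h, 0 ≤ p.2 j h r) ∧
        (∀ j h, p.1 j = ∑ r ∈ N.rateSet j h, p.2 j h r) ∧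
        ∀ l, v l ≤ ∑ j, ∑ h, ∑ r ∈ N.rateSet j h, p.2 j h r * (μ h).toReal * (r l : ℝ)} := by
    ext p
    exact ⟨fun h => ⟨h.1, h.2, h.3, h.4, h.5⟩, fun ⟨h1, h2, h3, h4, h5⟩ => ⟨h1, h2, h3, h4, h5⟩⟩
  rw [this]
  simp only [Set.ofPred_and, Set.ofPred_forall]
  refine IsClosed.inter ?_ (IsClosed.inter ?_ (IsClosed.inter ?_ (IsClosed.inter ?_ ?_)))
  · exact isClosed_iInter fun j => isClosed_le (by fun_prop) (by fun_prop)
  · exact isClosed_eq (by fun_prop) (by fun_prop)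
  · exact isClosed_iInter fun j => isClosed_iInter fun h => isClosed_iInter fun r =>
      isClosed_iInter fun _ => isClosed_le (by fun_prop) (by fun_prop)
  · exact isClosed_iInter fun j => isClosed_iInter fun h =>
      isClosed_eq (by fun_prop) (by fun_prop)
  · exact isClosed_iInter fun l => isClosed_le (by fun_prop) (by fun_prop)

theorem isCompact_lpSublevel (C₁ : ℝ) (v : N.Link → ℝ) (c : ℝ) :
    IsCompact (lpSublevel μ C₁ v c) := by
  have h1 : IsClosed {p : (Activation M → ℝ) × (Activation M → N.Channel → (N.Link → ℕ) → ℝ) |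
      lpObjective C₁ p.1 ≤ c} :=
    isClosed_le (by unfold lpObjective; fun_prop) continuous_const
  refine (isCompact_Icc (a := (0 : (Activation M → ℝ) ×
    (Activation M → N.Channel → (N.Link → ℕ) → ℝ))) (b := 1)).of_isClosed_subset
      ((isClosed_lpFeasible v).inter (isClosed_Icc.inter h1)) fun p hp => hp.2.1

/-- The program leaves `β j h r` free for `r` outside `R(j, h)`, so its feasible set is not compact.
Setting these irrelevant values to `0` brings any feasible point into the unit cube with the same
`σ`. -/
theorem LPFeasible.nonempty_lpSublevel {C₁ : ℝ} {v : N.Link → ℝ} {c : ℝ} {σ β}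
    (h : LPFeasible μ v σ β) (hc : lpObjective C₁ σ ≤ c) : (lpSublevel μ C₁ v c).Nonempty := by
  classical
  let β' : Activation M → N.Channel → (N.Link → ℕ) → ℝ :=
    fun j h r => if r ∈ N.rateSet j h then β j h r else 0
  have hβ : ∀ j h, ∀ r ∈ N.rateSet j h, β' j h r = β j h r := fun j h r hr => if_pos hr
  have hσ1 : ∀ j, σ j ≤ 1 := fun j => by
    rw [← h.σ_sum]
    exact Finset.single_le_sum (fun j _ => h.σ_nonneg j) (Finset.mem_univ j)
  refine ⟨(σ, β'), ⟨h.σ_nonneg, h.σ_sum, ?_, ?_, ?_⟩, ⟨⟨?_, ?_⟩, ?_, ?_⟩, hc⟩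
  · intro j k r hr
    exact (h.β_nonneg j k r hr).trans_eq (hβ j k r hr).symm
  · intro j k
    refine (h.β_sum j k).trans ?_
    exact Finset.sum_congr rfl fun r hr => (hβ j k r hr).symm
  · intro l
    refine (h.demand l).trans_eq (Finset.sum_congr rfl fun j _ => Finset.sum_congr rfl fun k _ =>
      Finset.sum_congr rfl fun r hr => ?_)
    rw [← hβ j k r hr]
  · exact fun j => h.σ_nonneg j
  · intro j k r
    change 0 ≤ β' j k r
    by_cases hr : r ∈ N.rateSet j k
    · rw [hβ j k r hr]
      exact h.β_nonneg j k r hr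
    · simp [β', hr]
  · exact fun j => hσ1 j
  · intro j k r
    change β' j k r ≤ 1
    by_cases hr : r ∈ N.rateSet j k
    · rw [hβ j k r hr]
      refine le_trans ?_ (hσ1 j)
      rw [h.β_sum j k]
      exact Finset.single_le_sum (fun r hr => h.β_nonneg j k r hr) hr
    · simp [β', hr]

/-- The values of the linear program are lower semicontinuous in the demand. -/
theorem exists_lpFeasible_of_forall_sub {C₁ : ℝ} {v : N.Link → ℝ} {c : ℝ}
    (h : ∀ δ > 0, ∃ σ β, LPFeasible μ (fun l => v l - δ) σ β ∧ lpObjective C₁ σ ≤ c) :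
    ∃ σ β, LPFeasible μ v σ β ∧ lpObjective C₁ σ ≤ c := by
  -- The sublevel sets for the demands `v - 1 / (k + 1)` are compact, nonempty and decreasing in
  -- `k`; a common point is feasible for `v` itself.
  have hne : (⋂ k : ℕ, lpSublevel μ C₁ (fun l => v l - 1 / ((k : ℝ) + 1)) c).Nonempty := by
    refine IsCompact.nonempty_iInter_of_sequence_nonempty_isCompact_isClosed _ ?_ ?_
      (isCompact_lpSublevel _ _ _) fun k => (isCompact_lpSublevel _ _ _).isClosed
    · intro k p hp
      refine ⟨hp.1.mono fun l => ?_, hp.2⟩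
      have : (1 : ℝ) / ((k + 1 : ℕ) + 1) ≤ 1 / ((k : ℝ) + 1) := by
        gcongr
        simp
      linarith
    · intro k
      obtain ⟨σ, β, h1, h2⟩ := h (1 / ((k : ℝ) + 1)) (by positivity)
      exact h1.nonempty_lpSublevel h2
  obtain ⟨p, hp⟩ := hne
  rw [Set.mem_iInter] at hp
  have h0 := (hp 0).1
  refine ⟨p.1, p.2, ⟨h0.1, h0.2, h0.3, h0.4, fun l => ?_⟩, (hp 0).2.2⟩
  have hlim : Tendsto (fun k : ℕ => v l - 1 / ((k : ℝ) + 1)) atTop (𝓝 (v l - 0)) :=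
    tendsto_const_nhds.sub tendsto_one_div_add_atTop_nhds_zero_nat
  rw [sub_zero] at hlim
  exact le_of_tendsto' hlim fun k => (hp k).1.demand l

theorem LPFeasible.exists_lpOptimal {v : N.Link → ℝ} {σ β} (h : LPFeasible μ v σ β) (C₁ : ℝ) :
    ∃ σ β, LPOptimal μ C₁ v σ β := by
  obtain ⟨p, hp, hmin⟩ := (isCompact_lpSublevel C₁ v (lpObjective C₁ σ)).exists_isMinOn
    (h.nonempty_lpSublevel le_rfl)
    (f := fun p => lpObjective C₁ p.1) (by unfold lpObjective; fun_prop)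
  refine ⟨p.1, p.2, hp.1, fun σ' β' h' => ?_⟩
  rcases le_total (lpObjective C₁ σ) (lpObjective C₁ σ') with hle | hle
  · exact hp.2.2.trans hle
  · obtain ⟨q, hq⟩ := h'.nonempty_lpSublevel (C₁ := C₁) le_rfl
    exact (hmin (a := q) ⟨hq.1, hq.2.1, hq.2.2.trans hle⟩).trans hq.2.2

theorem LPFeasible.convexComb {v w : N.Link → ℝ} {σ σ' β β'} (h : LPFeasible μ v σ β)
    (h' : LPFeasible μ w σ' β') {θ : ℝ} (h0 : 0 ≤ θ) (h1 : θ ≤ 1) :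
    LPFeasible μ (fun l => (1 - θ) * v l + θ * w l) (fun j => (1 - θ) * σ j + θ * σ' j)
      (fun j k r => (1 - θ) * β j k r + θ * β' j k r) := by
  have h2 : 0 ≤ 1 - θ := by linarith
  refine ⟨fun j => ?_, ?_, fun j k r hr => ?_, fun j k => ?_, fun l => ?_⟩
  · exact add_nonneg (mul_nonneg h2 (h.σ_nonneg j)) (mul_nonneg h0 (h'.σ_nonneg j))
  · rw [Finset.sum_add_distrib, ← Finset.mul_sum, ← Finset.mul_sum, h.σ_sum, h'.σ_sum]
    ring
  · exact add_nonneg (mul_nonneg h2 (h.β_nonneg j k r hr)) (mul_nonneg h0 (h'.β_nonneg j k r hr))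
  · rw [Finset.sum_add_distrib, ← Finset.mul_sum, ← Finset.mul_sum, ← h.β_sum, ← h'.β_sum]
  · simp only [add_mul, mul_assoc, Finset.sum_add_distrib, ← Finset.mul_sum]
    have := h.demand l
    have := h'.demand l
    simp only [mul_assoc] at *
    gcongr

theorem lpObjective_convexComb (C₁ θ : ℝ) (σ σ' : Activation M → ℝ) :
    lpObjective C₁ (fun j => (1 - θ) * σ j + θ * σ' j) =
      (1 - θ) * lpObjective C₁ σ + θ * lpObjective C₁ σ' := by
  simp only [lpObjective, add_mul, Finset.sum_add_distrib, mul_assoc, ← Finset.mul_sum]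
  ring

/-- If the demand `v + η` is feasible, then the optimal value at `v + ε` exceeds the one at `v` by
at most a multiple of `ε`. -/
theorem LPOptimal.objective_le {C₁ : ℝ} (hC₁ : 0 ≤ C₁) {v : N.Link → ℝ} {η ε : ℝ} (hη : 0 < η)
    (hε : 0 < ε) {σ₁ β₁} (h₁ : LPFeasible μ (fun l => v l + η) σ₁ β₁) {σ₀ β₀}
    (h₀ : LPFeasible μ v σ₀ β₀) {σ β} (h : LPOptimal μ C₁ (fun l => v l + ε) σ β) :
    lpObjective C₁ σ ≤ lpObjective C₁ σ₀ + C₁ * M / η * ε := by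
  have hM : 0 ≤ C₁ * M := mul_nonneg hC₁ (Nat.cast_nonneg M)
  rcases le_total ε η with hle | hle
  -- With `θ = ε / η`, the demand `v + ε` is `(1 - θ) v + θ (v + η)`, so the mixture of the two
  -- given points is feasible for it.
  · have hθ : 0 ≤ ε / η := by positivity
    have hθ1 : ε / η ≤ 1 := (div_le_one hη).2 hle
    have hc := (h₀.convexComb h₁ hθ hθ1).mono (w := fun l => v l + ε) fun l => by
      field_simp
      linarith
    refine (h.2 _ _ hc).trans ?_
    rw [lpObjective_convexComb]
    have ha := lpObjective_nonneg hC₁ h₀.σ_nonneg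
    have hb := lpObjective_le hC₁ h₁.σ_nonneg h₁.σ_sum
    calc _ ≤ lpObjective C₁ σ₀ + ε / η * (C₁ * M) := by nlinarith
      _ = _ := by ring
  -- For `ε ≥ η` the trivial bound `C₁ * M` on the objective suffices.
  · have ha := lpObjective_nonneg hC₁ h₀.σ_nonneg
    have hb := lpObjective_le hC₁ h.1.σ_nonneg h.1.σ_sum
    have : C₁ * M ≤ C₁ * M / η * ε := by
      rw [div_mul_eq_mul_div, le_div_iff₀ hη]
      gcongr
    linarith

/-! ### Lower bound: time averages under an ergodic policy -/

/-- A finite set `F` of states carries more than `1 - η` of the stationary mass, and the fraction of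
time spent in `F` converges to that mass. Any `K` that bounds all queues in `F` works, whatever the
initial state. -/
theorem Ergodic.exists_tail_le (he : Ergodic μ A φ) {η : ℝ} (hη : 0 < η) :
    ∃ K : ℕ, ∀ x : N.State, ∀ᶠ T : ℕ in atTop, ∀ l, (1 / (T : ℝ)) * ∑ t ∈ Finset.range T,
      (expect (stateLaw μ A φ x t) fun y => if K < y.2 l then 1 else 0).toReal ≤ η := by
  obtain ⟨π, hπ⟩ := he
  have hsum : HasSum (fun y => (π y).toReal) 1 := by
    have h := ENNReal.hasSum_toReal (f := π) (by rw [π.tsum_coe]; exact ENNReal.one_ne_top)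
    rwa [← ENNReal.tsum_toReal_eq π.apply_ne_top, π.tsum_coe, ENNReal.toReal_one] at h
  obtain ⟨F, hF⟩ := ((hsum.eventually (lt_mem_nhds (show 1 - η < 1 by linarith)))).exists
  refine ⟨∑ y ∈ F, ∑ l, y.2 l, fun x => ?_⟩
  have hlim : Tendsto (fun T : ℕ => ∑ y ∈ F, (1 / (T : ℝ)) * ∑ t ∈ Finset.range T,
      (stateLaw μ A φ x t y).toReal) atTop (𝓝 (∑ y ∈ F, (π y).toReal)) :=
    tendsto_finsetSum _ fun y _ => hπ x y
  filter_upwards [hlim.eventually (lt_mem_nhds hF), eventually_gt_atTop 0] with T hT hT0 l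
  have hT0' : (0 : ℝ) < T := Nat.cast_pos.2 hT0
  have key : ∀ t, (expect (stateLaw μ A φ x t) fun y =>
      if ∑ y ∈ F, ∑ l, y.2 l < y.2 l then 1 else 0).toReal ≤
        1 - ∑ y ∈ F, (stateLaw μ A φ x t y).toReal := by
    intro t
    set p := stateLaw μ A φ x t
    have h1 : ∑ y ∈ F, p y + expect p (fun y => if ∑ y ∈ F, ∑ l, y.2 l < y.2 l then 1 else 0) ≤ 1 := by
      classical
      have h2 : ∑ y ∈ F, p y = expect p fun y => if y ∈ F then 1 else 0 := by
        rw [expect, tsum_eq_sum (s := F)]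
        · exact Finset.sum_congr rfl fun y hy => by simp [hy]
        · intro y hy
          simp [hy]
      rw [h2, ← expect_add]
      refine expect_le_of_le p fun y => ?_
      by_cases hy : y ∈ F
      · have : y.2 l ≤ ∑ y ∈ F, ∑ l, y.2 l :=
          (Finset.single_le_sum (fun _ _ => Nat.zero_le _) (Finset.mem_univ l)).trans
            (Finset.single_le_sum (f := fun y : N.State => ∑ l, y.2 l)
              (fun _ _ => Nat.zero_le _) hy)
        rw [if_pos hy, if_neg this.not_gt, add_zero]
      · simp only [hy, if_false, zero_add]
        split_ifs <;> simp
    have h3 := ENNReal.toReal_mono ENNReal.one_ne_top h1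
    have hfin := ne_top_of_le_ne_top ENNReal.one_ne_top h1
    rw [ENNReal.toReal_add (ENNReal.add_ne_top.1 hfin).1 (ENNReal.add_ne_top.1 hfin).2,
      ENNReal.toReal_sum fun y _ => p.apply_ne_top y, ENNReal.toReal_one] at h3
    linarith
  calc _ ≤ (1 / (T : ℝ)) * ∑ t ∈ Finset.range T, (1 - ∑ y ∈ F, (stateLaw μ A φ x t y).toReal) := by
        gcongr with t _
        exact key t
    _ = 1 - ∑ y ∈ F, (1 / (T : ℝ)) * ∑ t ∈ Finset.range T, (stateLaw μ A φ x t y).toReal := by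
        rw [Finset.sum_sub_distrib, Finset.sum_comm, mul_sub, ← Finset.mul_sum]
        simp [hT0'.ne']
    _ ≤ η := by linarith

variable (μ φ) in
/-- The conditional expectation of the service that is offered to `l`. -/
noncomputable def meanService (l : N.Link) (y : N.State) : ℝ≥0∞ :=
  expect (φ.act y) fun j => expect μ fun h => expect (φ.alloc y j h) fun r => ((r l : ℕ) : ℝ≥0∞)

variable (μ A φ) in
/-- The probability that `j` is active and `r` is allocated in slot `t + 1` if the channel state
is `h`. -/
noncomputable def allocProb (x : N.State) (t : ℕ) (j : Activation M) (h : N.Channel)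
    (r : N.Link → ℕ) : ℝ≥0∞ :=
  expect (stateLaw μ A φ x t) fun y => φ.act y j * φ.alloc y j h r

theorem allocProb_le_one (x : N.State) (t : ℕ) (j : Activation M) (h : N.Channel)
    (r : N.Link → ℕ) : allocProb μ A φ x t j h r ≤ 1 :=
  expect_le_of_le _ fun _ => mul_le_one' (PMF.coe_le_one _ _) (PMF.coe_le_one _ _)

theorem expect_meanService (x : N.State) (t : ℕ) (l : N.Link) :
    expect (stateLaw μ A φ x t) (meanService μ φ l) =
      ∑ j, ∑ h, ∑ r ∈ N.rateSet j h, allocProb μ A φ x t j h r * μ h * (r l : ℝ≥0∞) := by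
  classical
  have h1 : meanService μ φ l = fun y => ∑ j, ∑ h, ∑ r ∈ N.rateSet j h,
      φ.act y j * φ.alloc y j h r * μ h * (r l : ℝ≥0∞) := by
    funext y
    rw [meanService, expect_eq_sum]
    refine Finset.sum_congr rfl fun j _ => ?_
    rw [expect_eq_sum, Finset.mul_sum]
    refine Finset.sum_congr rfl fun h _ => ?_
    rw [expect_eq_sum_of_support _ (φ.alloc_mem y j h), Finset.mul_sum, Finset.mul_sum]
    exact Finset.sum_congr rfl fun r _ => by ring
  rw [h1]
  simp only [expect_finset_sum, expect_mul_const, allocProb]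

theorem toReal_expect_meanService (x : N.State) (t : ℕ) (l : N.Link) :
    (expect (stateLaw μ A φ x t) (meanService μ φ l)).toReal =
      ∑ j, ∑ h, ∑ r ∈ N.rateSet j h,
        (allocProb μ A φ x t j h r).toReal * (μ h).toReal * (r l : ℝ) := by
  have hfin : ∀ j h r, allocProb μ A φ x t j h r * μ h * (r l : ℝ≥0∞) ≠ ∞ := fun j h r =>
    ENNReal.mul_ne_top (ENNReal.mul_ne_top
      (ne_top_of_le_ne_top ENNReal.one_ne_top (allocProb_le_one x t j h r)) (μ.apply_ne_top h))
      (ENNReal.natCast_ne_top _)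
  rw [expect_meanService, ENNReal.toReal_sum fun j _ => ENNReal.sum_ne_top.2 fun h _ =>
    ENNReal.sum_ne_top.2 fun r _ => hfin j h r]
  refine Finset.sum_congr rfl fun j _ => ?_
  rw [ENNReal.toReal_sum fun h _ => ENNReal.sum_ne_top.2 fun r _ => hfin j h r]
  refine Finset.sum_congr rfl fun h _ => ?_
  rw [ENNReal.toReal_sum fun r _ => hfin j h r]
  exact Finset.sum_congr rfl fun r _ => by simp [ENNReal.toReal_mul]

/-- The sum does not depend on `h`, since `J(t)` is chosen before the channel is seen; this is what
the constraint linking `σ` and `β` demands. -/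
theorem sum_allocProb (x : N.State) (t : ℕ) (j : Activation M) (h : N.Channel) :
    ∑ r ∈ N.rateSet j h, (allocProb μ A φ x t j h r).toReal =
      (((stateLaw μ A φ x t).bind φ.act) j).toReal := by
  classical
  rw [← ENNReal.toReal_sum fun r _ =>
    ne_top_of_le_ne_top ENNReal.one_ne_top (allocProb_le_one x t j h r)]
  simp only [allocProb]
  rw [← expect_finset_sum, PMF.bind_apply, expect]
  congr 1
  refine tsum_congr fun y => ?_
  rw [← Finset.mul_sum]
  have := expect_eq_sum_of_support _ (φ.alloc_mem y j h) fun _ => 1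
  simp only [expect_const, mul_one] at this
  rw [← this, mul_one]

/-- The drift of the truncated queue `min (Q_l, K + b)`. -/
theorem truncated_drift (l : N.Link) (K : ℕ) (y : N.State) :
    ((min (y.2 l) (K + A.bound) : ℕ) : ℝ≥0∞) + ENNReal.ofReal (A.rate l) ≤
      expect (step μ A φ y) (fun z => ((min (z.2 l) (K + A.bound) : ℕ) : ℝ≥0∞)) +
        (meanService μ φ l y + A.bound * if K < y.2 l then 1 else 0) := by
  -- The inequality holds pathwise. If `Q_l ≤ K`, then `Q_l + a ≤ K + b` and the truncation is
  -- inactive; if `Q_l > K`, the arrivals are paid for by the extra term `b`.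
  have h := expect_mono (φ.act y) fun j => expect_mono μ fun h => expect_mono (φ.alloc y j h)
    fun r => expect_mono A.law (f := fun a =>
      ((min (y.2 l) (K + A.bound) : ℕ) : ℝ≥0∞) + ((a l : ℕ) : ℝ≥0∞))
      (g := fun a => ((min (y.2 l + (a l : ℕ) - r l) (K + A.bound) : ℕ) : ℝ≥0∞) +
        (((r l : ℕ) : ℝ≥0∞) + A.bound * if K < y.2 l then 1 else 0)) fun a => by
      have ha : (a l : ℕ) ≤ A.bound := Nat.lt_succ_iff.1 (a l).2
      split_ifs
      · rw [mul_one]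
        norm_cast
        omega
      · rw [mul_zero, add_zero]
        norm_cast
        omega
  simp only [expect_add, expect_const, expect_arrival] at h
  rw [expect_step]
  simpa only [meanService] using h

theorem expectedCost_eq {C₀ C₁ : ℝ} (hC₀ : 0 ≤ C₀) (hC₁ : 0 ≤ C₁) (x : N.State) (t : ℕ) :
    expectedCost μ A φ C₀ C₁ x t = (expect (stateLaw μ A φ x t) fun y =>
      expect (φ.act y) fun j => ENNReal.ofReal (slotCost C₀ C₁ y.1 j)).toReal := by
  rw [expectedCost, ← toReal_expect_ofReal]
  · simp only [switchLaw, expect_bind, expect_map]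
  · exact fun p => add_nonneg (mul_nonneg hC₀ (offCount_nonneg _ _))
      (mul_nonneg hC₁ (activeCount_nonneg _))

theorem slotCost_nonneg {C₀ C₁ : ℝ} (hC₀ : 0 ≤ C₀) (hC₁ : 0 ≤ C₁) (j' j : Activation M) :
    0 ≤ slotCost C₀ C₁ j' j :=
  add_nonneg (mul_nonneg hC₀ (offCount_nonneg _ _)) (mul_nonneg hC₁ (activeCount_nonneg _))

theorem lpObjective_le_expectedCost {C₀ C₁ : ℝ} (hC₀ : 0 ≤ C₀) (hC₁ : 0 ≤ C₁) (x : N.State)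
    (t : ℕ) : lpObjective C₁ (fun j => (((stateLaw μ A φ x t).bind φ.act) j).toReal) ≤
      expectedCost μ A φ C₀ C₁ x t := by
  have h : lpObjective C₁ (fun j => (((stateLaw μ A φ x t).bind φ.act) j).toReal) =
      (expect ((stateLaw μ A φ x t).bind φ.act) fun j =>
        ENNReal.ofReal (C₁ * activeCount j)).toReal := by
    rw [toReal_expect_ofReal _ fun j => mul_nonneg hC₁ (activeCount_nonneg j), lpObjective,
      Finset.mul_sum]
    exact Finset.sum_congr rfl fun j _ => by ring
  rw [h, expectedCost_eq hC₀ hC₁, expect_bind]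
  refine ENNReal.toReal_mono ?_ (expect_mono _ fun y => expect_mono _ fun j => ?_)
  · refine ne_top_of_le_ne_top (ENNReal.ofReal_ne_top (r := C₀ * M + C₁ * M))
      (expect_le_of_le _ fun y => expect_le_of_le _ fun j => ENNReal.ofReal_le_ofReal ?_)
    exact add_le_add (mul_le_mul_of_nonneg_left (offCount_le _ _) hC₀)
      (mul_le_mul_of_nonneg_left (activeCount_le _) hC₁)
  · refine ENNReal.ofReal_le_ofReal ?_
    exact le_add_of_nonneg_left (mul_nonneg hC₀ (offCount_nonneg _ _))

/-- The time averages under an ergodic policy are almost feasible for the linear program. -/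
theorem Ergodic.eventually_lpFeasible (he : Ergodic μ A φ) {C₀ C₁ : ℝ} (hC₀ : 0 ≤ C₀)
    (hC₁ : 0 ≤ C₁) (x : N.State) {δ : ℝ} (hδ : 0 < δ) :
    ∀ᶠ T : ℕ in atTop, ∃ σ β, LPFeasible μ (fun l => A.rate l - δ) σ β ∧ lpObjective C₁ σ ≤
      (1 / (T : ℝ)) * ∑ t ∈ Finset.range T, expectedCost μ A φ C₀ C₁ x t := by
  set b : ℝ := (A.bound : ℝ)
  have hb : 0 ≤ b := Nat.cast_nonneg _
  -- Half of `δ` absorbs the time with `Q_l > K`, weighted by `b`; the other half absorbs the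
  -- boundary term `(K + b) / T`. The summand `1` allows `b = 0`.
  have hη : 0 < δ / (2 * (b + 1)) := by positivity
  obtain ⟨K, hK⟩ := he.exists_tail_le hη
  have hlim : Tendsto (fun T : ℕ => ((K : ℝ) + b) / T) atTop (𝓝 0) :=
    tendsto_const_div_atTop_nhds_zero_nat _
  filter_upwards [hK x, eventually_gt_atTop 0,
    hlim.eventually (gt_mem_nhds (half_pos hδ))] with T hT hT0 hT1
  have hT0' : (0 : ℝ) < T := Nat.cast_pos.2 hT0
  refine ⟨fun j => (1 / (T : ℝ)) * ∑ t ∈ Finset.range T,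
      (((stateLaw μ A φ x t).bind φ.act) j).toReal,
    fun j h r => (1 / (T : ℝ)) * ∑ t ∈ Finset.range T, (allocProb μ A φ x t j h r).toReal,
    ⟨fun j => by positivity, ?_, fun j h r _ => by positivity, fun j h => ?_, fun l => ?_⟩, ?_⟩
  · rw [← Finset.mul_sum, Finset.sum_comm]
    simp only [sum_toReal_eq_one]
    simp [hT0'.ne']
  · rw [← Finset.mul_sum, Finset.sum_comm]
    simp only [sum_allocProb]
  -- The truncated queue never exceeds `K + b`, so its final expectation is negligible after
  -- division by `T`; for `Q_l` itself ergodicity gives no such moment bound.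
  · have h1 := le_telescope μ A φ (truncated_drift l K) x T
    set P : ℕ → ℝ≥0∞ := fun t => expect (stateLaw μ A φ x t) fun y => if K < y.2 l then 1 else 0
    have hP : ∀ t, P t ≤ 1 := fun t => expect_le_of_le _ fun y => by split_ifs <;> simp
    have hS : ∀ t, expect (stateLaw μ A φ x t) (meanService μ φ l) ≠ ∞ := fun t => by
      rw [expect_meanService]
      exact ENNReal.sum_ne_top.2 fun j _ => ENNReal.sum_ne_top.2 fun h _ =>
        ENNReal.sum_ne_top.2 fun r _ => ENNReal.mul_ne_top (ENNReal.mul_ne_top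
          (ne_top_of_le_ne_top ENNReal.one_ne_top (allocProb_le_one x t j h r))
          (μ.apply_ne_top h)) (ENNReal.natCast_ne_top _)
    have hterm : ∀ t, (expect (stateLaw μ A φ x t) fun y =>
        meanService μ φ l y + A.bound * if K < y.2 l then 1 else 0) =
        ENNReal.ofReal ((expect (stateLaw μ A φ x t) (meanService μ φ l)).toReal +
          b * (P t).toReal) := fun t => by
      rw [expect_add, expect_const_mul, ENNReal.ofReal_add ENNReal.toReal_nonneg (by positivity),
        ENNReal.ofReal_toReal (hS t), ENNReal.ofReal_mul hb, ENNReal.ofReal_natCast,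
        ENNReal.ofReal_toReal (ne_top_of_le_ne_top ENNReal.one_ne_top (hP t))]
    simp only [hterm, expect_const] at h1
    rw [← ENNReal.ofReal_sum_of_nonneg (f := fun t =>
      (expect (stateLaw μ A φ x t) (meanService μ φ l)).toReal + b * (P t).toReal)
      fun t _ => by positivity] at h1
    have h2 : ENNReal.ofReal (T * A.rate l) ≤ ENNReal.ofReal ((K + b) + ∑ t ∈ Finset.range T,
        ((expect (stateLaw μ A φ x t) (meanService μ φ l)).toReal + b * (P t).toReal)) := by
      rw [ENNReal.ofReal_add (by positivity) (Finset.sum_nonneg fun t _ => by positivity)]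
      calc ENNReal.ofReal (T * A.rate l) =
            ∑ t ∈ Finset.range T, ENNReal.ofReal (A.rate l) := by
            rw [ENNReal.ofReal_mul hT0'.le]
            simp
        _ ≤ _ := le_add_self
        _ ≤ _ := h1
        _ ≤ _ := by
          gcongr
          refine expect_le_of_le _ fun y => ?_
          rw [show (K : ℝ) + b = ((K + A.bound : ℕ) : ℝ) by push_cast; rfl,
            ENNReal.ofReal_natCast]
          exact_mod_cast min_le_right _ _
    rw [ENNReal.ofReal_le_ofReal_iff (add_nonneg (by positivity)
      (Finset.sum_nonneg fun t _ => by positivity)), Finset.sum_add_distrib,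
      ← Finset.mul_sum] at h2
    have h3 : ∑ j, ∑ h, ∑ r ∈ N.rateSet j h, (1 / (T : ℝ)) *
        (∑ t ∈ Finset.range T, (allocProb μ A φ x t j h r).toReal) * (μ h).toReal * (r l : ℝ) =
        (1 / (T : ℝ)) * ∑ t ∈ Finset.range T,
          (expect (stateLaw μ A φ x t) (meanService μ φ l)).toReal := by
      simp only [toReal_expect_meanService]
      symm
      rw [Finset.sum_comm, Finset.mul_sum]
      refine Finset.sum_congr rfl fun j _ => ?_
      rw [Finset.sum_comm, Finset.mul_sum]
      refine Finset.sum_congr rfl fun h _ => ?_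
      rw [Finset.sum_comm, Finset.mul_sum]
      refine Finset.sum_congr rfl fun r _ => ?_
      rw [← Finset.sum_mul, ← Finset.sum_mul]
      ring
    rw [h3]
    have h4 := hT l
    have h5 : b * ((1 / (T : ℝ)) * ∑ t ∈ Finset.range T, (P t).toReal) ≤ δ / 2 := by
      refine (mul_le_mul_of_nonneg_left h4 hb).trans ?_
      rw [mul_div_assoc', div_le_div_iff₀ (by positivity) two_pos]
      nlinarith
    have h6 : A.rate l ≤ (K + b) / T + (1 / (T : ℝ)) * (∑ t ∈ Finset.range T,
          (expect (stateLaw μ A φ x t) (meanService μ φ l)).toReal) +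
            b * ((1 / (T : ℝ)) * ∑ t ∈ Finset.range T, (P t).toReal) := by
      rw [← mul_le_mul_iff_right₀ hT0']
      refine h2.trans_eq ?_
      field_simp
      ring
    linarith
  · calc _ = (1 / (T : ℝ)) * ∑ t ∈ Finset.range T,
          lpObjective C₁ (fun j => (((stateLaw μ A φ x t).bind φ.act) j).toReal) := by
          simp only [lpObjective, ← Finset.mul_sum, mul_assoc, Finset.sum_mul]
          rw [Finset.sum_comm]
          ring
      _ ≤ _ := by
        gcongr with t _
        exact lpObjective_le_expectedCost hC₀ hC₁ x t

theorem Ergodic.exists_lpFeasible (he : Ergodic μ A φ) {C₀ C₁ : ℝ} (hC₀ : 0 ≤ C₀)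
    (hC₁ : 0 ≤ C₁) (x : N.State) {c : ℝ} (hc : networkCost μ A φ C₀ C₁ x < c) :
    ∃ σ β, LPFeasible μ A.rate σ β ∧ lpObjective C₁ σ ≤ c := by
  have h := eventually_lt_of_limsup_lt hc
  refine exists_lpFeasible_of_forall_sub fun δ hδ => ?_
  obtain ⟨T, ⟨σ, β, h1, h2⟩, h3⟩ := ((he.eventually_lpFeasible hC₀ hC₁ x hδ).and h).exists
  exact ⟨σ, β, h1, h2.trans (EReal.coe_lt_coe_iff.1 h3).le⟩

theorem Ergodic.exists_lpFeasible_rate (he : Ergodic μ A φ) :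
    ∃ σ β, LPFeasible μ A.rate σ β := by
  -- With `C₁ = 0` the bound on the objective is void and only feasibility remains.
  obtain ⟨σ, β, h, -⟩ := exists_lpFeasible_of_forall_sub (μ := μ) (v := A.rate) (C₁ := 0) (c := 0)
    fun δ hδ => by
      obtain ⟨T, σ, β, h1, -⟩ := (he.eventually_lpFeasible le_rfl le_rfl
        (fun _ => false, fun _ => 0) hδ).exists
      exact ⟨σ, β, h1, by simp [lpObjective]⟩
  exact ⟨σ, β, h⟩

/-! ### Upper bound: the cost of the lazy activation chain -/

theorem sum_lazyMatrix_mul (σ : Activation M → ℝ) (ε : ℝ) (j' : Activation M)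
    (g : Activation M → ℝ) :
    ∑ j, lazyMatrix σ ε j' j * g j = ε * ∑ j, σ j * g j + (1 - ε) * g j' := by
  simp only [lazyMatrix, Matrix.add_apply, Matrix.smul_apply, Matrix.of_apply, smul_eq_mul,
    Matrix.one_apply, add_mul, Finset.sum_add_distrib, Finset.mul_sum]
  congr 1
  · exact Finset.sum_congr rfl fun j _ => by ring
  · simp

theorem networkCost_le {σ : Activation M → ℝ} {ε : ℝ} (h0 : 0 < ε) (h1 : ε < 1)
    (hσ : ∀ j, 0 ≤ σ j) (hσ1 : ∑ j, σ j = 1)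
    (hφ : ∀ x j, (φ.act x j).toReal = lazyMatrix σ ε x.1 j)
    {C₀ C₁ : ℝ} (hC₀ : 0 ≤ C₀) (hC₁ : 0 ≤ C₁) (x : N.State) :
    networkCost μ A φ C₀ C₁ x ≤ ((C₀ * M * ε + lpObjective C₁ σ : ℝ) : EReal) := by
  have h1' : 0 ≤ 1 - ε := by linarith
  set s : ℝ := ∑ j, σ j * activeCount j
  have hs : 0 ≤ s := Finset.sum_nonneg fun j _ => mul_nonneg (hσ j) (activeCount_nonneg j)
  set a : ℕ → ℝ≥0∞ := fun t =>
    expect (stateLaw μ A φ x t) fun y => ENNReal.ofReal (activeCount y.1)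
  have hatop : ∀ t, a t ≠ ∞ := fun t => ne_top_of_le_ne_top ENNReal.ofReal_ne_top
    (expect_le_of_le _ fun y => ENNReal.ofReal_le_ofReal (activeCount_le y.1))
  have hact : ∀ (y : N.State) (g : Activation M → ℝ), (∀ j, 0 ≤ g j) →
      expect (φ.act y) (fun j => ENNReal.ofReal (g j)) =
        ENNReal.ofReal (ε * ∑ j, σ j * g j + (1 - ε) * g y.1) := fun y g hg => by
    rw [expect_ofReal _ hg]
    simp only [hφ, sum_lazyMatrix_mul]
  -- The expected number of active stations evolves autonomously and contracts to its mean `s` under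
  -- `σ` at rate `1 - ε`.
  have hrec : ∀ t, (a (t + 1)).toReal = ε * s + (1 - ε) * (a t).toReal := by
    intro t
    have : a (t + 1) = ENNReal.ofReal (ε * s) + ENNReal.ofReal (1 - ε) * a t := by
      simp only [a]
      rw [expect_stateLaw_succ]
      simp only [expect_step, expect_const, hact _ _ activeCount_nonneg]
      rw [← expect_const_mul]
      conv_rhs => rw [← expect_const (stateLaw μ A φ x t) (ENNReal.ofReal (ε * s)), ← expect_add]
      congr 1
      funext y
      rw [ENNReal.ofReal_add (by positivity) (mul_nonneg h1' (activeCount_nonneg _)),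
        ENNReal.ofReal_mul h1']
    rw [this, ENNReal.toReal_add ENNReal.ofReal_ne_top
      (ENNReal.mul_ne_top ENNReal.ofReal_ne_top (hatop t)), ENNReal.toReal_mul,
      ENNReal.toReal_ofReal (by positivity), ENNReal.toReal_ofReal h1']
  have hform : ∀ t, (a t).toReal = s + (1 - ε) ^ t * ((a 0).toReal - s) := by
    intro t
    induction t with
    | zero => simp
    | succ t ih =>
      rw [hrec, ih]
      ring
  have hlim : Tendsto (fun t => (a t).toReal) atTop (𝓝 s) := by
    have h := (tendsto_pow_atTop_nhds_zero_of_lt_one h1' (by linarith)).mul_const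
      ((a 0).toReal - s) |>.const_add s
    simp only [zero_mul, add_zero] at h
    exact h.congr fun t => (hform t).symm
  have hcost : ∀ t, expectedCost μ A φ C₀ C₁ x t ≤ C₀ * M * ε + C₁ * (a (t + 1)).toReal := by
    intro t
    rw [expectedCost_eq hC₀ hC₁, hrec]
    refine ENNReal.toReal_le_of_le_ofReal (by positivity) ?_
    have : ENNReal.ofReal (C₀ * M * ε + C₁ * (ε * s + (1 - ε) * (a t).toReal)) =
        expect (stateLaw μ A φ x t) fun y => ENNReal.ofReal (C₀ * M * ε + C₁ * ε * s) +
          ENNReal.ofReal (C₁ * (1 - ε)) * ENNReal.ofReal (activeCount y.1) := by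
      rw [expect_add, expect_const, expect_const_mul,
        show C₀ * M * ε + C₁ * (ε * s + (1 - ε) * (a t).toReal) =
          (C₀ * M * ε + C₁ * ε * s) + (C₁ * (1 - ε)) * (a t).toReal by ring,
        ENNReal.ofReal_add (by positivity) (by positivity), ENNReal.ofReal_mul (by positivity),
        ENNReal.ofReal_toReal (hatop t)]
    rw [this]
    refine expect_mono _ fun y => ?_
    rw [hact y _ (slotCost_nonneg hC₀ hC₁ y.1), ← ENNReal.ofReal_mul (by positivity),
      ← ENNReal.ofReal_add (by positivity)
        (mul_nonneg (by positivity) (activeCount_nonneg _))]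
    refine ENNReal.ofReal_le_ofReal ?_
    have hoff : ∑ j, σ j * offCount y.1 j ≤ M := by
      calc ∑ j, σ j * offCount y.1 j ≤ ∑ j, σ j * M :=
            Finset.sum_le_sum fun j _ => mul_le_mul_of_nonneg_left (offCount_le _ _) (hσ j)
        _ = M := by rw [← Finset.sum_mul, hσ1, one_mul]
    have hsplit : ∑ j, σ j * slotCost C₀ C₁ y.1 j =
        C₀ * ∑ j, σ j * offCount y.1 j + C₁ * s := by
      simp only [slotCost, s, mul_add, Finset.sum_add_distrib, Finset.mul_sum]
      congr 1 <;> exact Finset.sum_congr rfl fun j _ => by ring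
    -- Staying put causes no switching cost, so only the redraw, of weight `ε`, contributes to the
    -- `C₀` term.
    rw [hsplit, slotCost, offCount_self]
    have := mul_le_mul_of_nonneg_left hoff (mul_nonneg h0.le hC₀)
    linarith
  have hav : Tendsto (fun T : ℕ => (1 / (T : ℝ)) * ∑ t ∈ Finset.range T,
      (C₀ * M * ε + C₁ * (a (t + 1)).toReal)) atTop (𝓝 (C₀ * M * ε + lpObjective C₁ σ)) := by
    have h := (((hlim.comp (tendsto_add_atTop_nat 1)).const_mul C₁).const_add
      (C₀ * M * ε)).cesaro
    simp only [one_div]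
    exact h
  have hE := (continuous_coe_real_ereal.tendsto _).comp hav
  rw [← hE.limsup_eq]
  refine limsup_le_limsup (Eventually.of_forall fun T => ?_)
  simp only [Function.comp]
  refine EReal.coe_le_coe_iff.2 ?_
  gcongr with t _
  exact hcost t

/-! ### Existence of static-split + Max-Weight rules -/

theorem rateSet_nonempty (j : Activation M) (h : N.Channel) : (N.rateSet j h).Nonempty :=
  (N.fullRates_nonempty h).image _

theorem LPFeasible.exists_isStaticSplitMaxWeight {v : N.Link → ℝ} {σ β}
    (hf : LPFeasible μ v σ β) {ε : ℝ} (h0 : 0 < ε) (h1 : ε < 1) :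
    ∃ φ : N.Policy, IsStaticSplitMaxWeight φ σ ε := by
  have hnn : ∀ j' j, 0 ≤ lazyMatrix σ ε j' j := fun j' j => by
    simp only [lazyMatrix, Matrix.add_apply, Matrix.smul_apply, Matrix.of_apply, smul_eq_mul,
      Matrix.one_apply]
    have := mul_nonneg h0.le (hf.σ_nonneg j)
    split_ifs <;> linarith
  have hsum : ∀ j', ∑ j, lazyMatrix σ ε j' j = 1 := fun j' => by
    have := sum_lazyMatrix_mul σ ε j' fun _ => 1
    simp only [mul_one, hf.σ_sum] at this
    linarith
  -- The maximizer is chosen as a function of the set `R(j, h)` and not of `h`. Channel states that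
  -- agree on the active stations have the same set, hence the same choice, as `alloc_obs` requires.
  have hex : ∀ (q : N.Link → ℕ) (s : Finset (N.Link → ℕ)), ∃ r, s.Nonempty →
      r ∈ s ∧ ∀ r' ∈ s, ∑ l, q l * r' l ≤ ∑ l, q l * r l := fun q s => by
    by_cases hs : s.Nonempty
    · obtain ⟨r, hr⟩ := s.exists_max_image (fun r => ∑ l, q l * r l) hs
      exact ⟨r, fun _ => hr⟩
    · exact ⟨0, fun h => absurd h hs⟩
  choose best hbest using hex
  refine ⟨⟨fun x => PMF.ofFintype (fun j => ENNReal.ofReal (lazyMatrix σ ε x.1 j)) ?_,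
    fun x j h => PMF.pure (best x.2 (N.rateSet j h)), ?_, ?_⟩, ?_, ?_⟩
  · rw [← ENNReal.ofReal_sum_of_nonneg fun j _ => hnn _ j, hsum, ENNReal.ofReal_one]
  · intro x j h r hr
    rw [PMF.support_pure, Set.mem_singleton_iff] at hr
    rw [hr]
    exact (hbest _ _ (rateSet_nonempty j h)).1
  · intro x j h h' hh
    rw [show N.rateSet j h = N.rateSet j h' from N.rates_local j h h' hh]
  · intro x j
    exact ENNReal.toReal_ofReal (hnn _ j)
  · intro x j h r hr
    rw [PMF.support_pure, Set.mem_singleton_iff] at hr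
    rw [hr]
    exact hbest _ _ (rateSet_nonempty j h)

/-! ### Maximal weights and the Lyapunov drift -/

variable (N) in
/-- The maximal weight `max_{r ∈ R(j, h)} q · r`. -/
def maxWeight (j : Activation M) (h : N.Channel) (q : N.Link → ℕ) : ℕ :=
  (N.rateSet j h).sup fun r => ∑ l, q l * r l

theorem IsMaxWeight.eq {q : N.Link → ℕ} {j : Activation M} {h : N.Channel} {r : N.Link → ℕ}
    (hr : IsMaxWeight q j h r) : ∑ l, q l * r l = N.maxWeight j h q :=
  le_antisymm (Finset.le_sup (f := fun r : N.Link → ℕ => ∑ l, q l * r l) hr.1)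
    (Finset.sup_le hr.2)

theorem maxWeight_le {R : ℕ} (hR : ∀ j h, ∀ r ∈ N.rateSet j h, ∀ l, r l ≤ R) (j : Activation M)
    (h : N.Channel) (q : N.Link → ℕ) : N.maxWeight j h q ≤ R * ∑ l, q l := by
  refine Finset.sup_le fun r hr => ?_
  rw [Finset.mul_sum]
  exact Finset.sum_le_sum fun l _ => by
    rw [mul_comm]
    exact Nat.mul_le_mul_right _ (hR j h r hr l)

theorem maxWeight_le_add {R : ℕ} (hR : ∀ j h, ∀ r ∈ N.rateSet j h, ∀ l, r l ≤ R)
    (j : Activation M) (h : N.Channel) {q q' : N.Link → ℕ} (hq : ∀ l, q l ≤ q' l + R) :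
    N.maxWeight j h q ≤ N.maxWeight j h q' + Fintype.card N.Link * (R * R) := by
  refine Finset.sup_le fun r hr => ?_
  calc ∑ l, q l * r l ≤ ∑ l, (q' l * r l + R * R) := Finset.sum_le_sum fun l _ => by
        calc q l * r l ≤ (q' l + R) * r l := Nat.mul_le_mul_right _ (hq l)
          _ = q' l * r l + R * r l := by ring
          _ ≤ _ := by gcongr; exact hR j h r hr l
    _ = ∑ l, q' l * r l + Fintype.card N.Link * (R * R) := by
        rw [Finset.sum_add_distrib, Finset.sum_const, Finset.card_univ, smul_eq_mul]
    _ ≤ _ := by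
        gcongr
        exact Finset.le_sup (f := fun r : N.Link → ℕ => ∑ l, q' l * r l) hr

variable (μ) in
/-- The expectation of the maximal weight over the channel state. -/
noncomputable def meanWeight (j : Activation M) (q : N.Link → ℕ) : ℝ :=
  ∑ h, (μ h).toReal * (N.maxWeight j h q : ℝ)

theorem meanWeight_le {R : ℕ} (hR : ∀ j h, ∀ r ∈ N.rateSet j h, ∀ l, r l ≤ R) (j : Activation M)
    (q : N.Link → ℕ) : meanWeight μ j q ≤ R * ∑ l, (q l : ℝ) := by
  calc meanWeight μ j q ≤ ∑ h, (μ h).toReal * (R * ∑ l, (q l : ℝ)) := by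
        unfold meanWeight
        gcongr with h _
        exact_mod_cast maxWeight_le hR j h q
    _ = _ := by rw [← Finset.sum_mul, sum_toReal_eq_one, one_mul]

theorem meanWeight_le_add {R : ℕ} (hR : ∀ j h, ∀ r ∈ N.rateSet j h, ∀ l, r l ≤ R)
    (j : Activation M) {q q' : N.Link → ℕ} (hq : ∀ l, q l ≤ q' l + R) :
    meanWeight μ j q ≤ meanWeight μ j q' + Fintype.card N.Link * (R * R) := by
  calc meanWeight μ j q ≤
        ∑ h, (μ h).toReal * ((N.maxWeight j h q' : ℝ) + Fintype.card N.Link * (R * R)) := by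
        unfold meanWeight
        gcongr with h _
        exact_mod_cast maxWeight_le_add hR j h hq
    _ = _ := by
        simp only [mul_add, Finset.sum_add_distrib, ← Finset.sum_mul]
        rw [sum_toReal_eq_one, one_mul]
        rfl

/-- The allocation encoded by `β` serves the demand `v`, and for each activation and channel state
Max-Weight achieves at least the weight of any randomized allocation. -/
theorem LPFeasible.le_meanWeight {v : N.Link → ℝ} {σ β} (hf : LPFeasible μ v σ β)
    (q : N.Link → ℕ) : ∑ l, (q l : ℝ) * v l ≤ ∑ j, σ j * meanWeight μ j q := by
  calc ∑ l, (q l : ℝ) * v l ≤ ∑ l, (q l : ℝ) *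
        ∑ j, ∑ h, ∑ r ∈ N.rateSet j h, β j h r * (μ h).toReal * (r l : ℝ) := by
        gcongr with l _
        exact hf.demand l
    _ = ∑ j, ∑ h, ∑ r ∈ N.rateSet j h, β j h r * ((μ h).toReal * ∑ l, (q l : ℝ) * (r l : ℝ)) := by
        simp only [Finset.mul_sum]
        rw [Finset.sum_comm]
        refine Finset.sum_congr rfl fun j _ => ?_
        rw [Finset.sum_comm]
        refine Finset.sum_congr rfl fun h _ => ?_
        rw [Finset.sum_comm]
        exact Finset.sum_congr rfl fun r _ => Finset.sum_congr rfl fun l _ => by ring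
    _ ≤ ∑ j, ∑ h, ∑ r ∈ N.rateSet j h, β j h r * ((μ h).toReal * (N.maxWeight j h q : ℝ)) := by
        refine Finset.sum_le_sum fun j _ => Finset.sum_le_sum fun h _ =>
          Finset.sum_le_sum fun r hr => mul_le_mul_of_nonneg_left
            (mul_le_mul_of_nonneg_left ?_ ENNReal.toReal_nonneg) (hf.β_nonneg j h r hr)
        exact_mod_cast Finset.le_sup (f := fun r : N.Link → ℕ => ∑ l, q l * r l) hr
    _ = _ := by
        refine Finset.sum_congr rfl fun j _ => ?_
        rw [meanWeight, Finset.mul_sum]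
        refine Finset.sum_congr rfl fun h _ => ?_
        rw [← Finset.sum_mul, ← hf.β_sum]

theorem sq_truncated_sub_le (q a r : ℕ) {c : ℝ} (ha : (a : ℝ) ≤ c) (hr : (r : ℝ) ≤ c) :
    ((q + a - r : ℕ) : ℝ) ^ 2 ≤ (q : ℝ) ^ 2 + 2 * (q * a) - 2 * (q * r) + c ^ 2 := by
  have ha0 : (0 : ℝ) ≤ a := Nat.cast_nonneg a
  have hr0 : (0 : ℝ) ≤ r := Nat.cast_nonneg r
  have h1 : ((a : ℝ) - r) ^ 2 ≤ c ^ 2 := sq_le_sq' (by linarith) (by linarith)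
  have h2 : ((q + a - r : ℕ) : ℝ) ^ 2 ≤ ((q : ℝ) + a - r) ^ 2 := by
    rcases le_total r (q + a) with h | h
    · rw [Nat.cast_sub h]
      push_cast
      exact le_rfl
    · rw [Nat.sub_eq_zero_of_le h]
      simpa using sq_nonneg _
  nlinarith

variable (μ) in
/-- The Lyapunov function: the squared queue lengths, corrected by the expected weight of the
current activation state and shifted by a constant. -/
noncomputable def lyapunov (c D : ℝ) (y : N.State) : ℝ :=
  ∑ l, (y.2 l : ℝ) ^ 2 - c * meanWeight μ y.1 y.2 + D

/-- The correction is at most `c * R * q_l` summed over the links, and `q_l ^ 2 - c * R * q_l + (c *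
R) ^ 2 ≥ 0` by completing the square; this fixes the shift `D`. -/
theorem lyapunov_nonneg {R : ℕ} (hR : ∀ j h, ∀ r ∈ N.rateSet j h, ∀ l, r l ≤ R) {c : ℝ}
    (hc : 0 ≤ c) (y : N.State) :
    0 ≤ lyapunov μ c (Fintype.card N.Link * (c * R) ^ 2) y := by
  have h1 := mul_le_mul_of_nonneg_left (meanWeight_le (μ := μ) hR y.1 y.2) hc
  have h2 : 0 ≤ ∑ l, ((y.2 l : ℝ) ^ 2 - c * R * y.2 l + (c * R) ^ 2) :=
    Finset.sum_nonneg fun l _ => by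
      nlinarith [sq_nonneg ((y.2 l : ℝ) - c * R / 2), sq_nonneg (c * R)]
  rw [Finset.sum_add_distrib, Finset.sum_sub_distrib, ← Finset.mul_sum, Finset.sum_const,
    Finset.card_univ, nsmul_eq_mul] at h2
  unfold lyapunov
  linarith

theorem sum_law_mul_inner (q : N.Link → ℕ) :
    ∑ a, (A.law a).toReal * ∑ l, (q l : ℝ) * ((a l : ℕ) : ℝ) = ∑ l, (q l : ℝ) * A.rate l := by
  simp only [Arrivals.rate, Finset.mul_sum]
  rw [Finset.sum_comm]
  exact Finset.sum_congr rfl fun l _ => Finset.sum_congr rfl fun a _ => by ring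

theorem sum_toReal_mul_add {α : Type*} [Fintype α] (p : PMF α) (c : ℝ) (f : α → ℝ) :
    ∑ a, (p a).toReal * (c + f a) = c + ∑ a, (p a).toReal * f a := by
  simp only [mul_add, Finset.sum_add_distrib, ← Finset.sum_mul, sum_toReal_eq_one, one_mul]

/-- The one-step drift of the Lyapunov function under a static-split + Max-Weight rule. -/
theorem expect_step_lyapunov_le {σ β} {ε η : ℝ} (h0 : 0 < ε) (h1 : ε < 1)
    (hη : 0 ≤ η) (hf : LPFeasible μ (fun l => A.rate l + η) σ β) (hφ : IsStaticSplitMaxWeight φ σ ε)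
    {R : ℕ} (hR : ∀ j h, ∀ r ∈ N.rateSet j h, ∀ l, r l ≤ R) (y : N.State) :
    let c := 2 * (1 - ε) / ε
    let D := Fintype.card N.Link * (c * R) ^ 2
    let B := Fintype.card N.Link * ((A.bound : ℝ) + R) ^ 2 + c * (Fintype.card N.Link * (R * R))
    expect (step μ A φ y) (fun z => ENNReal.ofReal (lyapunov μ c D z)) +
      ENNReal.ofReal (2 * η * ∑ l, (y.2 l : ℝ)) ≤ ENNReal.ofReal (lyapunov μ c D y + B) := by
  intro c D B
  have hc : 0 ≤ c := div_nonneg (by linarith) h0.le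
  -- A bound on the next value of the Lyapunov function that is free of `r`: every allocated `r` has
  -- maximal weight. The two parts of `B` pay for the squared increments and for replacing the new
  -- queues by the old ones in the correction.
  let F : Activation M → N.Channel → (N.Link → Fin (A.bound + 1)) → ℝ := fun j h a =>
    (∑ l, (y.2 l : ℝ) ^ 2 + B + D - c * meanWeight μ j y.2) +
      (-(2 * (N.maxWeight j h y.2 : ℝ)) + 2 * ∑ l, (y.2 l : ℝ) * ((a l : ℕ) : ℝ))
  have hF : ∀ j h, ∀ r ∈ (φ.alloc y j h).support, ∀ a : N.Link → Fin (A.bound + 1),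
      lyapunov μ c D (j, fun l => y.2 l + (a l : ℕ) - r l) ≤ F j h a := by
    intro j h r hr a
    have hmw := hφ.2 y j h r hr
    have hrR := hR j h r hmw.1
    have hsq : ∑ l, ((y.2 l + (a l : ℕ) - r l : ℕ) : ℝ) ^ 2 ≤ ∑ l, ((y.2 l : ℝ) ^ 2 +
        2 * ((y.2 l : ℝ) * ((a l : ℕ) : ℝ)) - 2 * ((y.2 l : ℝ) * (r l : ℝ)) +
          ((A.bound : ℝ) + R) ^ 2) := by
      refine Finset.sum_le_sum fun l _ => sq_truncated_sub_le _ _ _ ?_ ?_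
      · have : (a l : ℕ) ≤ A.bound := Nat.lt_succ_iff.1 (a l).2
        exact_mod_cast this.trans (Nat.le_add_right _ _)
      · exact_mod_cast (hrR l).trans (Nat.le_add_left _ _)
    rw [Finset.sum_add_distrib, Finset.sum_sub_distrib, Finset.sum_add_distrib, ← Finset.mul_sum,
      ← Finset.mul_sum, Finset.sum_const, Finset.card_univ, nsmul_eq_mul] at hsq
    have hw : ∑ l, (y.2 l : ℝ) * (r l : ℝ) = N.maxWeight j h y.2 := by
      rw [← hmw.eq]
      push_cast
      rfl
    have hlip := mul_le_mul_of_nonneg_left (meanWeight_le_add (μ := μ) hR j (q := y.2)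
      (q' := fun l => y.2 l + (a l : ℕ) - r l) fun l => by have := hrR l; omega) hc
    rw [hw] at hsq
    simp only [lyapunov, F, B]
    linarith
  have hF0 : ∀ j h a, 0 ≤ F j h a := fun j h a => by
    obtain ⟨r, hr⟩ := (φ.alloc y j h).support_nonempty
    exact (lyapunov_nonneg hR hc _).trans (hF j h r hr a)
  have hsum : ∑ j, (φ.act y j).toReal * ∑ h, (μ h).toReal * ∑ a, (A.law a).toReal * F j h a =
      ∑ l, (y.2 l : ℝ) ^ 2 + B + D + 2 * ∑ l, (y.2 l : ℝ) * A.rate l -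
        (2 + c) * ∑ j, (φ.act y j).toReal * meanWeight μ j y.2 := by
    have e1 : ∀ j, ∑ h, (μ h).toReal * ∑ a, (A.law a).toReal * F j h a =
        (∑ l, (y.2 l : ℝ) ^ 2 + B + D + 2 * ∑ l, (y.2 l : ℝ) * A.rate l) +
          -(2 + c) * meanWeight μ j y.2 := by
      intro j
      have e2 : ∀ h, ∑ a, (A.law a).toReal * F j h a =
          (∑ l, (y.2 l : ℝ) ^ 2 + B + D - c * meanWeight μ j y.2 +
            2 * ∑ l, (y.2 l : ℝ) * A.rate l) + -2 * (N.maxWeight j h y.2 : ℝ) := by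
        intro h
        simp only [F, sum_toReal_mul_add]
        rw [← sum_law_mul_inner, Finset.mul_sum]
        simp only [mul_left_comm _ (2 : ℝ)]
        ring
      simp only [e2, sum_toReal_mul_add]
      simp only [mul_left_comm _ (-2 : ℝ), ← Finset.mul_sum]
      rw [← meanWeight]
      ring
    simp only [e1, sum_toReal_mul_add]
    simp only [mul_left_comm _ (-(2 + c)), ← Finset.mul_sum]
    ring
  have hle : expect (step μ A φ y) (fun z => ENNReal.ofReal (lyapunov μ c D z)) ≤
      expect (φ.act y) fun j => expect μ fun h => expect A.law fun a =>
        ENNReal.ofReal (F j h a) := by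
    rw [expect_step]
    refine expect_mono _ fun j => expect_mono _ fun h => ?_
    refine (expect_mono_support _ fun r hr => expect_mono _ fun a =>
      ENNReal.ofReal_le_ofReal (hF j h r hr a)).trans (expect_const _ _).le
  refine (add_le_add_left hle _).trans ?_
  have n1 : ∀ j h, 0 ≤ ∑ a, (A.law a).toReal * F j h a := fun j h =>
    Finset.sum_nonneg fun a _ => mul_nonneg ENNReal.toReal_nonneg (hF0 j h a)
  have n2 : ∀ j, 0 ≤ ∑ h, (μ h).toReal * ∑ a, (A.law a).toReal * F j h a := fun j =>
    Finset.sum_nonneg fun h _ => mul_nonneg ENNReal.toReal_nonneg (n1 j h)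
  have n3 := Finset.sum_nonneg fun j (_ : j ∈ Finset.univ) =>
    mul_nonneg (ENNReal.toReal_nonneg (a := φ.act y j)) (n2 j)
  simp only [expect_ofReal _ (hF0 _ _), expect_ofReal _ (n1 _), expect_ofReal _ n2]
  rw [← ENNReal.ofReal_add n3 (mul_nonneg (by linarith)
    (Finset.sum_nonneg fun l _ => Nat.cast_nonneg _))]
  refine ENNReal.ofReal_le_ofReal ?_
  rw [hsum]
  simp only [hφ.1, sum_lazyMatrix_mul]
  have hw := hf.le_meanWeight y.2
  simp only [mul_add, Finset.sum_add_distrib, ← Finset.sum_mul] at hw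
  -- These two identities determine `c`. The weight `-(2 + c)` of the new activation state splits
  -- into `-2` on its average under `σ` and `-c` on the old state, and the latter is exactly the
  -- correction already present in `lyapunov μ c D y`.
  have hcε : (2 + c) * ε = 2 := by
    simp only [c]
    field_simp
    ring
  have hcε' : (2 + c) * (1 - ε) = c := by
    simp only [c]
    field_simp
    ring
  rw [mul_add (2 + c), ← mul_assoc, ← mul_assoc, hcε, hcε']
  unfold lyapunov
  linarith

/-! ### Stability from the negative drift -/

theorem queueProb_eq (x : N.State) (q : ℝ) (t : ℕ) : queueProb μ A φ x q t =
    (expect (stateLaw μ A φ x t) fun y => if ∑ l, (y.2 l : ℝ) ≤ q then 1 else 0).toReal := by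
  classical
  rw [queueProb, PMF.toOuterMeasure_apply, expect]
  congr 1
  refine tsum_congr fun y => ?_
  rw [Set.indicator_apply]
  by_cases hy : ∑ l, (y.2 l : ℝ) ≤ q
  · rw [if_pos hy, if_pos (show y ∈ {y : N.State | ∑ l, (y.2 l : ℝ) ≤ q} from hy), mul_one]
  · rw [if_neg hy, if_neg (show y ∉ {y : N.State | ∑ l, (y.2 l : ℝ) ≤ q} from hy), mul_zero]

theorem IsStaticSplitMaxWeight.stable {σ β} {ε η : ℝ} (h0 : 0 < ε) (h1 : ε < 1) (hη : 0 < η)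
    (hf : LPFeasible μ (fun l => A.rate l + η) σ β) (hφ : IsStaticSplitMaxWeight φ σ ε) :
    Stable μ A φ := by
  obtain ⟨R, hR⟩ := exists_rate_bound N
  have hdrift := fun y => expect_step_lyapunov_le h0 h1 hη.le hf hφ hR y
  set c := 2 * (1 - ε) / ε
  set D := Fintype.card N.Link * (c * R) ^ 2
  set B := Fintype.card N.Link * ((A.bound : ℝ) + R) ^ 2 + c * (Fintype.card N.Link * (R * R))
  have hc : 0 ≤ c := div_nonneg (by linarith) h0.le
  have hB : 0 ≤ B := by positivity
  have hV : ∀ y : N.State, 0 ≤ lyapunov μ c D y := lyapunov_nonneg hR hc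
  -- Above the level `q = Lv / (2 * η)` the drift is at most `B - Lv`. Telescoping bounds the
  -- fraction of time below `q` from below by `1 - B / Lv - V(x) / (Lv * T)`, where `V` is the
  -- Lyapunov function. Since `B / Lv ≤ 1/4` and the last term is eventually below `1/8`, this is at
  -- least `5/8`. Neither `q` nor `1/2` depends on `x`.
  set Lv : ℝ := 4 * (B + 1)
  have hL : 0 < Lv := by positivity
  set q : ℝ := Lv / (2 * η)
  have hq : 0 < q := by positivity
  have hqL : 2 * η * q = Lv := by
    simp only [q]
    field_simp
  refine ⟨q, 1 / 2, hq, by norm_num, fun x => ?_⟩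
  set P : ℕ → ℝ≥0∞ := fun t => expect (stateLaw μ A φ x t) fun y =>
    if ∑ l, (y.2 l : ℝ) ≤ q then 1 else 0
  have hP : ∀ t, P t ≤ 1 := fun t => expect_le_of_le _ fun y => by split_ifs <;> simp
  have hstep : ∀ y : N.State,
      expect (step μ A φ y) (fun z => ENNReal.ofReal (lyapunov μ c D z)) + ENNReal.ofReal Lv ≤
        ENNReal.ofReal (lyapunov μ c D y) + (ENNReal.ofReal B + ENNReal.ofReal Lv *
          if ∑ l, (y.2 l : ℝ) ≤ q then 1 else 0) := by
    intro y
    rw [← add_assoc, ← ENNReal.ofReal_add (hV y) hB]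
    split_ifs with hy
    · rw [mul_one]
      gcongr
      exact le_self_add.trans (hdrift y)
    · rw [mul_zero, add_zero]
      refine le_trans ?_ (hdrift y)
      gcongr
      rw [← hqL]
      gcongr
      exact (not_le.1 hy).le
  have hbound : ∀ T : ℕ, T * Lv ≤ lyapunov μ c D x + T * B +
      Lv * ∑ t ∈ Finset.range T, (P t).toReal := by
    intro T
    have h := telescope_le μ A φ hstep x T
    simp only [expect_add, expect_const, expect_const_mul] at h
    rw [← ENNReal.ofReal_le_ofReal_iff (add_nonneg (add_nonneg (hV x) (by positivity))
      (by positivity))]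
    calc ENNReal.ofReal (T * Lv) = ∑ t ∈ Finset.range T, ENNReal.ofReal Lv := by
          rw [ENNReal.ofReal_mul (Nat.cast_nonneg T)]
          simp
      _ ≤ _ := le_add_self
      _ ≤ _ := h
      _ = _ := by
        rw [ENNReal.ofReal_add (add_nonneg (hV x) (by positivity)) (by positivity),
          ENNReal.ofReal_add (hV x) (by positivity), ENNReal.ofReal_mul (Nat.cast_nonneg T),
          ENNReal.ofReal_mul hL.le, ENNReal.ofReal_sum_of_nonneg fun t _ => ENNReal.toReal_nonneg,
          Finset.sum_add_distrib, ← Finset.mul_sum, Finset.sum_const, Finset.card_range,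
          nsmul_eq_mul, ENNReal.ofReal_natCast, ← add_assoc]
        simp only [ENNReal.ofReal_toReal (ne_top_of_le_ne_top ENNReal.one_ne_top (hP _))]
        rfl
  have hle1 : ∀ T : ℕ, (1 / (T : ℝ)) * ∑ t ∈ Finset.range T, (P t).toReal ≤ 1 := fun T => by
    calc _ ≤ (1 / (T : ℝ)) * ∑ t ∈ Finset.range T, 1 := by
          gcongr with t _
          exact ENNReal.toReal_le_of_le_ofReal zero_le_one (by simpa using hP t)
      _ ≤ 1 := by
          rw [Finset.sum_const, Finset.card_range, nsmul_eq_mul, mul_one, one_div]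
          exact inv_mul_le_one
  simp only [queueProb_eq]
  refine lt_of_lt_of_le (by norm_num : (1 : ℝ) / 2 < 5 / 8) (le_liminf_of_le
    (isCoboundedUnder_ge_of_le atTop hle1) ?_)
  have hlim : Tendsto (fun T : ℕ => lyapunov μ c D x / Lv / T) atTop (𝓝 0) :=
    tendsto_const_div_atTop_nhds_zero_nat _
  filter_upwards [eventually_gt_atTop 0,
    hlim.eventually (gt_mem_nhds (by norm_num : (0 : ℝ) < 1 / 8))] with T hT0 hT
  have hT0' : (0 : ℝ) < T := Nat.cast_pos.2 hT0
  have hb := hbound T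
  change 5 / 8 ≤ (1 / (T : ℝ)) * ∑ t ∈ Finset.range T, (P t).toReal
  rw [one_div, inv_mul_eq_div, le_div_iff₀ hT0']
  rw [div_lt_iff₀ hT0', div_lt_iff₀ hL] at hT
  rw [← mul_le_mul_iff_right₀ hL]
  have h5 : (T : ℝ) * B ≤ T * Lv / 4 := by
    simp only [Lv]
    nlinarith
  linarith

end Network
end SwitchNet

/-! ### Comparison of the two bounds -/

theorem mainTheorem3 (M n : ℕ) (C₀ C₁ : ℝ) (hC₀ : 0 ≤ C₀) (hC₁ : 0 ≤ C₁) :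
    ∃ κ : ℝ, ∀ (X : Type u) (N : SwitchNet.Network M n X) (μ : PMF N.Channel) (lam : N.Link → ℝ),
      ∃ γ : ℝ → ℝ, StrictMonoOn γ (Set.Ioi 0) ∧ Tendsto γ (𝓝[>] 0) (𝓝 0) ∧
        ∀ εg : ℝ, 0 < εg →
          (μ, fun l => lam l + 2 * εg) ∈ SwitchNet.Network.capacitySet N →
          ∀ εs ∈ Set.Ioo (0 : ℝ) 1,
            (∃ σ β, SwitchNet.Network.LPOptimal μ C₁ (fun l => lam l + εg) σ β) ∧
            ∀ σ β, SwitchNet.Network.LPOptimal μ C₁ (fun l => lam l + εg) σ β →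
              (∃ φ : N.Policy, SwitchNet.Network.IsStaticSplitMaxWeight φ σ εs) ∧
              ∀ φ : N.Policy, SwitchNet.Network.IsStaticSplitMaxWeight φ σ εs →
                ∀ A : N.Arrivals, A.rate = lam →
                  (∀ x : N.State,
                    SwitchNet.Network.networkCost μ A φ C₀ C₁ x ≤
                      SwitchNet.Network.optimalCost μ A C₀ C₁ x
                        + ((κ * εs + γ εg : ℝ) : EReal)) ∧
                  SwitchNet.Network.Stable μ A φ := by
  refine ⟨C₀ * M, fun X N μ lam => ?_⟩
  have hM : 0 ≤ C₁ * M := mul_nonneg hC₁ (Nat.cast_nonneg M)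
  -- The slope must not depend on `εg`, so one `η` with `lam + η` feasible is fixed in advance; if
  -- none exists, the claim is vacuous. The added `1` keeps `γ` strictly increasing when `C₁ * M =
  -- 0`.
  have hslope : ∃ g : ℝ, 0 < g ∧ ∀ ε > 0,
      (∃ σ β, SwitchNet.Network.LPFeasible μ (fun l => lam l + ε) σ β) →
        ∀ σ₀ β₀, SwitchNet.Network.LPFeasible μ lam σ₀ β₀ → ∀ σ β,
          SwitchNet.Network.LPOptimal μ C₁ (fun l => lam l + ε) σ β →
            SwitchNet.Network.lpObjective C₁ σ ≤
              SwitchNet.Network.lpObjective C₁ σ₀ + g * ε := by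
    by_cases h : ∃ η > 0, ∃ σ β, SwitchNet.Network.LPFeasible μ (fun l => lam l + η) σ β
    · obtain ⟨η, hη, σ₁, β₁, h₁⟩ := h
      refine ⟨C₁ * M / η + 1, by positivity, fun ε hε _ σ₀ β₀ h₀ σ β hopt => ?_⟩
      have := hopt.objective_le hC₁ hη hε h₁ h₀
      linarith
    · exact ⟨1, one_pos, fun ε hε hf => absurd ⟨ε, hε, hf⟩ h⟩
  obtain ⟨g, hg, hslope⟩ := hslope
  refine ⟨fun ε => g * ε, fun a _ b _ hab => mul_lt_mul_of_pos_left hab hg, ?_, ?_⟩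
  · have h : Tendsto (fun ε : ℝ => g * ε) (𝓝 0) (𝓝 (g * 0)) :=
      (continuous_const.mul continuous_id).tendsto 0
    rw [mul_zero] at h
    exact h.mono_left nhdsWithin_le_nhds
  · rintro εg hεg ⟨A', hA', ψ, hψ, -⟩ εs ⟨hs0, hs1⟩
    have hrate : ∀ l, A'.rate l = lam l + 2 * εg := fun l => congrFun hA' l
    -- The process `A'` that witnesses membership in the capacity set need not be related to `A`;
    -- only its mean vector enters the linear program.
    obtain ⟨σ', β', hf'⟩ := hψ.exists_lpFeasible_rate
    have hf : SwitchNet.Network.LPFeasible μ (fun l => lam l + εg) σ' β' :=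
      hf'.mono fun l => by rw [hrate]; linarith
    refine ⟨hf.exists_lpOptimal C₁, fun σ β hopt =>
      ⟨hopt.1.exists_isStaticSplitMaxWeight hs0 hs1, fun φ hφ A hA => ⟨fun x => ?_, ?_⟩⟩⟩
    · have hlow : ((SwitchNet.Network.lpObjective C₁ σ - g * εg : ℝ) : EReal) ≤
          SwitchNet.Network.optimalCost μ A C₀ C₁ x := by
        -- It suffices to bound every real `c` above the cost of `ξ`: such a `c` dominates the
        -- objective of some point that is feasible at `lam`.
        refine le_iInf fun ξ => le_iInf fun hξ => EReal.le_of_forall_lt_iff_le.1 fun c hc => ?_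
        obtain ⟨σ₀, β₀, h₀, hc₀⟩ := hξ.1.exists_lpFeasible hC₀ hC₁ x hc
        rw [hA] at h₀
        have := hslope εg hεg ⟨σ', β', hf⟩ σ₀ β₀ h₀ σ β hopt
        exact EReal.coe_le_coe_iff.2 (by linarith)
      calc SwitchNet.Network.networkCost μ A φ C₀ C₁ x
          ≤ ((C₀ * M * εs + SwitchNet.Network.lpObjective C₁ σ : ℝ) : EReal) :=
            SwitchNet.Network.networkCost_le hs0 hs1 hopt.1.σ_nonneg hopt.1.σ_sum hφ.1 hC₀ hC₁ x
        _ = ((SwitchNet.Network.lpObjective C₁ σ - g * εg : ℝ) : EReal) +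
              ((C₀ * M * εs + g * εg : ℝ) : EReal) := by
            rw [← EReal.coe_add]
            congr 1
            ring
        _ ≤ _ := add_le_add_left hlow _
    · subst hA
      exact hφ.stable hs0 hs1 hεg hopt.1
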